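/- Let $b\ge 2$ and let $\mathbb{T}_b$ be the $b$-ary tree: its root $\rho$ has degree $1$ and every vertex $v\neq\rho$ has a parent $v^{(0)}$ and exactly $b$ children $v^{(1)},\dots,v^{(b)}$. A rotor configuration is a map $r$ from the set of non-root vertices to $\{0,1,\dots,b\}$; it means that the rotor at $v$ points to $v^{(r(v))}$. At each step of the rotor walk, if the particle is at $v\ne\rho$, the rotor at $v$ is first advanced to the next neighbour in the cyclic order $v^{(0)},v^{(1)},\dots,v^{(b)}$ and then the particle moves to that neighbour; from $\rho$ the particle moves to its only child. A particle started at $\rho$ is run until its first return to $\rho$; if it never returns, it escapes to infinity, visiting each vertex only finitely often, so that in either case a final rotor configuration is well defined. Particles are run from $\rho$ one after the other, each starting with the rotor configuration left by the previous one, and $E_n(\mathbb{T}_b,r)$ is the number of the first $n$ particles that escape, when the initial configuration is $r$. Let $\mathcal{E}$ be the probability that simple symmetric random walk on $\mathbb{T}_b$ started at $\rho$ never returns to $\rho$. Let $R=(R(v))_{v\neq\rho}$ be a random rotor configuration on $\mathbb{T}_b$ whose entries are independent and identically distributed random variables in $\{0,1,\dots,b\}$ whose common law is not concentrated at a single point,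 and let $v\ne\rho$ be any vertex. Then $\mathcal{E}=\frac{b-1}{b}$, and (i) if $\mathbb{E}R(v)<b-1$, then almost surely $\displaystyle\lim_{n\to\infty}\frac{E_n(\mathbb{T}_b,R)}{n}=\mathcal{E}$; (ii) if $\mathbb{E}R(v)\ge b-1$, then almost surely $E_n(\mathbb{T}_b,R)=0$ for all $n\ge 0$. -/

import Mathlib

open MeasureTheory ProbabilityTheory Filter Topology

namespace RotorTree

/-- Non-root vertices of the `b`-ary tree, written as finite words: `[]` is the only child of the
root, and `i :: v` is the child number `i + 1` of `v` (for `i = 0, …, b - 1`). -/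
abbrev NonRoot (b : ℕ) := List (Fin b)

/-- Vertices of the `b`-ary tree: `none` is the root, which has degree one. -/
abbrev Vertex (b : ℕ) := Option (NonRoot b)

/-- The parent of a non-root vertex. -/
def parent {b : ℕ} : NonRoot b → Vertex b
  | [] => none
  | _ :: v => some v

/-- The neighbours `v⁽⁰⁾, v⁽¹⁾, …, v⁽ᵇ⁾` of a non-root vertex `v`, in the cyclic order of the rotor:
number `0` is the parent, numbers `1, …, b` are the children. -/
def nbr {b : ℕ} (v : NonRoot b) (k : Fin (b + 1)) : Vertex b :=
  Fin.cases (parent v) (fun i => some (i :: v)) k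

/-- A rotor configuration: the rotor at `v` points to `nbr v (r v)`. (The rotor at the root always
points to its only child.) -/
abbrev Config (b : ℕ) := NonRoot b → Fin (b + 1)

/-- One step of the rotor walk: increment the rotor at the current position (cyclically, that is
modulo `b + 1`), then move the particle to where the rotor now points. -/
def step {b : ℕ} : Vertex b × Config b → Vertex b × Config b
  | (none, r) => (some [], r)
  | (some v, r) => (nbr v (r v + 1), Function.update r v (r v + 1))

/-- The particle position and the rotors after `t` steps, for a particle started at the root with
rotor configuration `r`. -/
def walk {b : ℕ} (r : Config b) (t : ℕ) : Vertex b × Config b := step^[t] (none, r)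

/-- The particle started at the root comes back to the root after finitely many steps. -/
def Returns {b : ℕ} (r : Config b) : Prop := ∃ t : ℕ, 1 ≤ t ∧ (walk r t).1 = none

/-- The particle escapes to infinity. -/
def Escapes {b : ℕ} (r : Config b) : Prop := ¬ Returns r

theorem walk_succ {b : ℕ} (r : Config b) (t : ℕ) : walk r (t + 1) = step (walk r t) :=
  Function.iterate_succ_apply' _ _ _

theorem step_of_pos {b : ℕ} {s : Vertex b × Config b} {v : NonRoot b} (h : s.1 = some v) :
    step s = (nbr v (s.2 v + 1), Function.update s.2 v (s.2 v + 1)) := by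
  obtain ⟨p, c⟩ := s
  simp only at h
  subst h
  rfl

theorem step_of_ne {b : ℕ} {s : Vertex b × Config b} {v : NonRoot b} (h : s.1 ≠ some v) :
    (step s).2 v = s.2 v := by
  obtain ⟨p, c⟩ := s
  rcases p with _ | w
  · rfl
  · have : v ≠ w := fun e => h (by simp [e])
    simp [step, Function.update_of_ne this]

/-- If from some time on the particle is never at the parent of `v`, then it stops visiting
`v`. -/
theorem eventually_ne_of_parent {b : ℕ} (r : Config b) (v : NonRoot b)
    (hp : ∀ᶠ t in atTop, (walk r t).1 ≠ parent v) :
    ∀ᶠ t in atTop, (walk r t).1 ≠ some v := by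
  obtain ⟨T, hT⟩ := eventually_atTop.1 hp
  by_contra hinf
  have hfreq : ∀ N, ∃ t ≥ N, (walk r t).1 = some v := by
    intro N
    by_contra hN
    push Not at hN
    exact hinf (eventually_atTop.2 ⟨N, hN⟩)
  have key : ∀ k : ℕ, ∃ t ≥ T, k ≤ (((walk r t).2 v : Fin (b + 1)) : ℕ) := by
    intro k
    induction k with
    | zero => exact ⟨T, le_rfl, Nat.zero_le _⟩
    | succ k ih =>
      obtain ⟨t, ht, hk⟩ := ih
      have hex : ∃ m, (walk r (t + m)).1 = some v := by
        obtain ⟨s, hs, hs'⟩ := hfreq t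
        exact ⟨s - t, by rwa [Nat.add_sub_cancel' hs]⟩
      classical
      have hconst : ∀ m ≤ Nat.find hex, (walk r (t + m)).2 v = (walk r t).2 v := by
        intro m
        induction m with
        | zero => intro _; rfl
        | succ m ihm =>
          intro hm
          rw [← ihm (by omega), ← add_assoc, walk_succ]
          exact step_of_ne (Nat.find_min hex (by omega))
      have hs := Nat.find_spec hex
      have hc := hconst _ le_rfl
      set s := t + Nat.find hex with hsdef
      have hstep := step_of_pos hs
      rw [← walk_succ, hc] at hstep
      refine ⟨s + 1, by omega, ?_⟩
      rw [hstep]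
      simp only [Function.update_self]
      have hne : (walk r t).2 v + 1 ≠ 0 := by
        intro h0
        apply hT (s + 1) (by omega)
        rw [hstep, h0]
        rfl
      have hlast : (walk r t).2 v ≠ Fin.last b := by
        intro h
        exact hne (by rw [h]; exact Fin.last_add_one b)
      rw [Fin.val_add_one]
      simp only [hlast, if_false]
      omega
  obtain ⟨t, -, ht⟩ := key (b + 1)
  have := ((walk r t).2 v).isLt
  omega

/-- An escaping particle visits each vertex only finitely many times. -/
theorem Escapes.eventually_ne {b : ℕ} {r : Config b} (h : Escapes r) (v : NonRoot b) :
    ∀ᶠ t in atTop, (walk r t).1 ≠ some v := by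
  induction v with
  | nil =>
    exact eventually_ne_of_parent r [] (eventually_atTop.2 ⟨1, fun t ht h0 => h ⟨t, ht, h0⟩⟩)
  | cons i w ih => exact eventually_ne_of_parent r (i :: w) ih

/-- While a particle escapes, the rotor at each vertex eventually stops moving. -/
theorem Escapes.exists_eventually_eq {b : ℕ} {r : Config b} (h : Escapes r) (v : NonRoot b) :
    ∃ k : Fin (b + 1), ∀ᶠ t in atTop, (walk r t).2 v = k := by
  obtain ⟨T, hT⟩ := eventually_atTop.1 (h.eventually_ne v)
  refine ⟨(walk r T).2 v, eventually_atTop.2 ⟨T, fun t ht => ?_⟩⟩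
  induction t, ht using Nat.le_induction with
  | base => rfl
  | succ t ht ih => rw [walk_succ, step_of_ne (hT t ht), ih]

open Classical in
/-- The rotor configuration left behind by one particle started at the root: the one at the first
return to the root if the particle returns, and the limiting one if it escapes. -/
noncomputable def final {b : ℕ} (r : Config b) : Config b :=
  if h : Returns r then (walk r (Nat.find h)).2
  else fun v => (Escapes.exists_eventually_eq (r := r) h v).choose

open Classical in
/-- The number `E_n` of escaping particles among the first `n`, when particles are run one after the
other from the root, each starting with the rotors left behind by the previous one. -/
noncomputable def escapeCount {b : ℕ} (r : Config b) (n : ℕ) : ℕ :=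
  ((Finset.range n).filter fun i => Escapes (final^[i] r)).card

/-- The walk from the root in which the `t`-th step leads from a non-root vertex `v` to its
neighbour number `u t`, and from the root to its only neighbour. -/
def srw {b : ℕ} (u : ℕ → Fin (b + 1)) : ℕ → Vertex b
  | 0 => none
  | t + 1 => match srw u t with
    | none => some []
    | some v => nbr v (u t)

/-- The probability that simple symmetric random walk on the `b`-ary tree, started at the root,
never returns to the root. The walk is driven by independent uniform choices of neighbours. -/
noncomputable def escapeProb (b : ℕ) : ℝ :=
  (Measure.infinitePi fun _ : ℕ => (PMF.uniformOfFintype (Fin (b + 1))).toMeasure).real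
    {u | ∀ t : ℕ, 1 ≤ t → srw u t ≠ none}

end RotorTree

/-! The proof rests on self-similarity. Inside branch `i` the particle performs a rotor walk on a
copy of the tree with rotors `sub r i`, and between two returns to the root each branch is entered
exactly once. Hence `escapeCount r n` is the largest `m ≤ n` with `m ≤ ∑ i, escapeCount (sub r i) (n
- m + live (r []) i)`: see `escapeCount_le_sum` and `sum_le_escapeCount`. Iterating this recursion
from the trivial count `n` gives `levelCount`, which decreases to `escapeCount` as the level grows
(`exists_levelCount_eq`).

For every configuration, branch rates at most `u` give a rate at most `b * u / (1 + b * u)`.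
Iteration from `1` converges to `(b - 1) / b`, so no configuration escapes faster than simple random
walk.

Call a child live if the rotor reaches it before the parent. For i.i.d. rotors the live edges form a
Galton-Watson tree with offspring `b - R` and mean `b - 𝔼 R`. If this mean is at most one and the
law is nondegenerate, the extinction argument, combined with induction on the number of particles,
shows that nobody escapes (`ae_escapeCount_eq_zero`).

If the mean exceeds one, the inverse lower rate behaves like an effective resistance: `(rate r)⁻¹`
is at most `1` plus the parallel combination of the branch resistances. A second-moment estimate for
the energy of a flow on live edges gives a positive rate with positive probability
(`exists_pos_measure_rate`). Since a large resistance requires large resistance in all `b`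
independent branches, its tail decays fast and its mean `I` is finite. Averaging the inequality
between harmonic and arithmetic means yields `I ≤ 1 + I / b`, that is `I ≤ b / (b - 1)`. The
universal upper bound gives `(rate r)⁻¹ ≥ b / (b - 1)` pointwise, so equality holds almost surely
(`ae_rate_eq`).

The value of `escapeProb` is computed separately from the distance of simple random walk to the root
(`escapeProb_eq`). -/

namespace RotorTree

/-! ### Branches of a rotor configuration -/

/-- The configuration seen by the branch of the tree above the child `[i]` of `[]`. -/
def sub {b : ℕ} (r : Config b) (i : Fin b) : Config b := fun w => r (w ++ [i])

/-- Replace the branch number `i` of `r` by `s`. -/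
def graft {b : ℕ} (r : Config b) (i : Fin b) (s : Config b) : Config b :=
  fun u => if u.getLast? = some i then s u.dropLast else r u

@[simp] theorem graft_nil {b : ℕ} (r : Config b) (i : Fin b) (s : Config b) :
    graft r i s [] = r [] := by simp [graft]

@[simp] theorem graft_append_self {b : ℕ} (r : Config b) (i : Fin b) (s : Config b)
    (w : NonRoot b) : graft r i s (w ++ [i]) = s w := by simp [graft]

theorem graft_append_of_ne {b : ℕ} (r : Config b) {i j : Fin b} (h : j ≠ i) (s : Config b)
    (w : NonRoot b) : graft r i s (w ++ [j]) = r (w ++ [j]) := by simp [graft, h]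

@[simp] theorem sub_graft_self {b : ℕ} (r : Config b) (i : Fin b) (s : Config b) :
    sub (graft r i s) i = s := by
  funext w; simp [sub]

theorem sub_graft_of_ne {b : ℕ} (r : Config b) {i j : Fin b} (h : j ≠ i) (s : Config b) :
    sub (graft r i s) j = sub r j := by
  funext w; simp [sub, graft_append_of_ne r h]

theorem graft_sub {b : ℕ} (r : Config b) (i : Fin b) : graft r i (sub r i) = r := by
  funext u
  rcases List.eq_nil_or_concat u with rfl | ⟨w, j, rfl⟩
  · simp
  · rw [List.concat_eq_append]
    by_cases h : j = i
    · subst h; simp [sub]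
    · rw [graft_append_of_ne r h]

@[simp] theorem sub_update_nil {b : ℕ} (r : Config b) (k : Fin (b + 1)) (i : Fin b) :
    sub (Function.update r [] k) i = sub r i := by
  funext w
  exact Function.update_of_ne (by simp) _ _

theorem update_graft {b : ℕ} (r : Config b) (i : Fin b) (s : Config b) (w : NonRoot b)
    (k : Fin (b + 1)) :
    Function.update (graft r i s) (w ++ [i]) k = graft r i (Function.update s w k) := by
  funext u
  rcases List.eq_nil_or_concat u with rfl | ⟨w', j, rfl⟩
  · rw [Function.update_of_ne (by simp)]; simp
  · rw [List.concat_eq_append]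
    by_cases h : j = i
    · subst h
      by_cases hw : w' = w
      · subst hw; simp
      · rw [Function.update_of_ne (by simpa using hw)]
        simp [Function.update_of_ne hw]
    · rw [Function.update_of_ne (by simp [h]), graft_append_of_ne r h, graft_append_of_ne r h]

/-- The embedding of the tree as the branch number `i`, whose root is `[]`. -/
def branch {b : ℕ} (i : Fin b) : Vertex b → Vertex b
  | none => some []
  | some w => some (w ++ [i])

theorem branch_ne_none {b : ℕ} (i : Fin b) (x : Vertex b) : branch i x ≠ none := by
  cases x <;> simp [branch]

theorem nbr_append {b : ℕ} (w : NonRoot b) (i : Fin b) (k : Fin (b + 1)) :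
    nbr (w ++ [i]) k = branch i (nbr w k) := by
  cases k using Fin.cases with
  | zero => cases w <;> rfl
  | succ j => rfl

theorem step_branch {b : ℕ} (i : Fin b) (r : Config b) (s : Vertex b × Config b)
    (h : s.1 ≠ none) :
    step (branch i s.1, graft r i s.2) = (branch i (step s).1, graft r i (step s).2) := by
  obtain ⟨x, c⟩ := s
  rcases x with _ | w
  · exact absurd rfl h
  · simp [branch, step, nbr_append, update_graft]

/-! ### Decomposition of the walk of one particle -/

theorem walk_one {b : ℕ} (r : Config b) : walk r 1 = (some [], r) := rfl

theorem walk_two {b : ℕ} (r : Config b) :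
    walk r 2 = (nbr [] (r [] + 1), Function.update r [] (r [] + 1)) := rfl

/-- The comparison starts at time `1`: a particle coming back from a branch stands at `[]`, like a
fresh particle after its first step. -/
theorem walk_add_of_eq {b : ℕ} {r r' : Config b} {T : ℕ} (h : walk r (T + 1) = walk r' 1)
    (t : ℕ) : walk r (T + (t + 1)) = walk r' (t + 1) := by
  induction t with
  | zero => exact h
  | succ t ih => rw [← add_assoc, walk_succ, ih, ← walk_succ]

theorem walk_branch {b : ℕ} {r : Config b} {i : Fin b} (hi : r [] = i.castSucc) (t : ℕ)
    (ht : ∀ u, 1 ≤ u → u < t + 1 → (walk (sub r i) u).1 ≠ none) :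
    walk r (t + 2) = (branch i (walk (sub r i) (t + 1)).1,
      graft (Function.update r [] i.succ) i (walk (sub r i) (t + 1)).2) := by
  induction t with
  | zero =>
    have h2 := graft_sub (Function.update r [] i.succ) i
    rw [sub_update_nil] at h2
    rw [zero_add, zero_add, walk_two, walk_one, hi, Fin.coeSucc_eq_succ]
    simp [h2, branch, nbr]
  | succ t ih =>
    rw [walk_succ, ih (fun u h1 h2 => ht u h1 (by omega)), step_branch _ _ _
      (ht _ (by omega) (by omega)), ← walk_succ]

theorem eventually_atTop_add_iff (k : ℕ) {p : ℕ → Prop} :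
    (∀ᶠ t in atTop, p (t + k)) ↔ ∀ᶠ t in atTop, p t := by
  conv_rhs => rw [← map_add_atTop_eq_nat k, eventually_map]

theorem final_apply_of_eventually {b : ℕ} {r : Config b} (h : Escapes r) {v : NonRoot b}
    {k : Fin (b + 1)} (hk : ∀ᶠ t in atTop, (walk r t).2 v = k) : final r v = k := by
  have h' : ¬ Returns r := h
  have := (Escapes.exists_eventually_eq (r := r) h v).choose_spec
  obtain ⟨t, h1, h2⟩ := (this.and hk).exists
  rw [final, dif_neg h']
  exact h1.symm.trans h2

theorem Escapes.eventually_eq_final {b : ℕ} {r : Config b} (h : Escapes r) (v : NonRoot b) :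
    ∀ᶠ t in atTop, (walk r t).2 v = final r v := by
  obtain ⟨k, hk⟩ := h.exists_eventually_eq v
  rwa [final_apply_of_eventually h hk]

/-- The particle first returns to the root at time `t`. -/
def FirstReturn {b : ℕ} (r : Config b) (t : ℕ) : Prop :=
  1 ≤ t ∧ (walk r t).1 = none ∧ ∀ u, 1 ≤ u → u < t → (walk r u).1 ≠ none

theorem FirstReturn.returns {b : ℕ} {r : Config b} {t : ℕ} (h : FirstReturn r t) : Returns r :=
  ⟨t, h.1, h.2.1⟩

theorem Returns.exists_firstReturn {b : ℕ} {r : Config b} (h : Returns r) :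
    ∃ t, FirstReturn r t := by
  classical
  refine ⟨Nat.find h, (Nat.find_spec h).1, (Nat.find_spec h).2, fun u h1 h2 h3 => ?_⟩
  exact Nat.find_min h h2 ⟨h1, h3⟩

theorem FirstReturn.final_eq {b : ℕ} {r : Config b} {t : ℕ} (h : FirstReturn r t) :
    final r = (walk r t).2 := by
  classical
  rw [final, dif_pos h.returns]
  congr 2
  refine (Nat.find_eq_iff _).2 ?_
  exact ⟨⟨h.1, h.2.1⟩, fun u hu h' => h.2.2 u h'.1 hu h'.2⟩

open Classical in
/-- The time of the first return to the root, infinite if the particle escapes. -/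
noncomputable def retTime {b : ℕ} (r : Config b) : ℕ∞ :=
  if h : Returns r then (Nat.find h : ℕ∞) else ⊤

theorem FirstReturn.retTime_eq {b : ℕ} {r : Config b} {t : ℕ} (h : FirstReturn r t) :
    retTime r = t := by
  classical
  rw [retTime, dif_pos h.returns, Nat.cast_inj]
  refine (Nat.find_eq_iff _).2 ?_
  exact ⟨⟨h.1, h.2.1⟩, fun u hu h' => h.2.2 u h'.1 hu h'.2⟩

theorem Escapes.retTime_eq {b : ℕ} {r : Config b} (h : Escapes r) : retTime r = ⊤ := by
  rw [retTime, dif_neg h]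

theorem retTime_ne_top {b : ℕ} {r : Config b} (h : ¬ Escapes r) : retTime r ≠ ⊤ := by
  obtain ⟨t, ht⟩ := (not_not.1 h : Returns r).exists_firstReturn
  rw [ht.retTime_eq]
  exact ENat.natCast_ne_top t

theorem firstReturn_of_last {b : ℕ} {r : Config b} (h : r [] = Fin.last b) :
    FirstReturn r 2 := by
  refine ⟨by omega, ?_, fun u h1 h2 => ?_⟩
  · rw [walk_two, h, Fin.last_add_one]; rfl
  · obtain rfl : u = 1 := by omega
    simp [walk_one]

theorem not_escapes_of_last {b : ℕ} {r : Config b} (h : r [] = Fin.last b) : ¬ Escapes r :=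
  fun h' => h' (firstReturn_of_last h).returns

theorem final_of_last {b : ℕ} {r : Config b} (h : r [] = Fin.last b) :
    final r = Function.update r [] 0 := by
  rw [(firstReturn_of_last h).final_eq, walk_two, h, Fin.last_add_one]

/-- The configuration after the particle has been sent to the branch `i` and has left it (either
back to `[]` or to infinity). -/
noncomputable def advance {b : ℕ} (r : Config b) (i : Fin b) : Config b :=
  graft (Function.update r [] i.succ) i (final (sub r i))

@[simp] theorem advance_nil {b : ℕ} (r : Config b) (i : Fin b) : advance r i [] = i.succ := by
  simp [advance]

theorem sub_advance_self {b : ℕ} (r : Config b) (i : Fin b) :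
    sub (advance r i) i = final (sub r i) := by simp [advance]

theorem sub_advance_of_ne {b : ℕ} (r : Config b) {i j : Fin b} (h : j ≠ i) :
    sub (advance r i) j = sub r j := by simp [advance, sub_graft_of_ne _ h]

theorem escapes_of_sub {b : ℕ} {r : Config b} {i : Fin b} (hi : r [] = i.castSucc)
    (h : Escapes (sub r i)) : Escapes r := by
  rintro ⟨t, h1, h2⟩
  rcases t with _ | _ | t
  · omega
  · simp [walk_one] at h2
  · rw [walk_branch hi t (fun u hu _ h0 => h ⟨u, hu, h0⟩)] at h2
    exact branch_ne_none _ _ h2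

theorem final_of_escapes_sub {b : ℕ} {r : Config b} {i : Fin b} (hi : r [] = i.castSucc)
    (h : Escapes (sub r i)) : final r = advance r i := by
  have hw : ∀ t, walk r (t + 2) = _ :=
    fun t => walk_branch hi t (fun u hu _ h0 => h ⟨u, hu, h0⟩)
  funext v
  refine final_apply_of_eventually (escapes_of_sub hi h) ?_
  rw [← eventually_atTop_add_iff 2]
  simp only [hw, advance]
  rcases List.eq_nil_or_concat v with rfl | ⟨w, j, rfl⟩
  · simp
  · rw [List.concat_eq_append]
    by_cases hj : j = i
    · subst hj
      simp only [graft_append_self]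
      exact (eventually_atTop_add_iff 1).2 (h.eventually_eq_final w)
    · simp [graft_append_of_ne _ hj]

theorem walk_add_of_firstReturn_sub {b : ℕ} {r : Config b} {i : Fin b} (hi : r [] = i.castSucc)
    {T : ℕ} (h : FirstReturn (sub r i) T) (t : ℕ) :
    walk r (T + (t + 1)) = walk (advance r i) (t + 1) := by
  apply walk_add_of_eq
  obtain ⟨T, rfl⟩ := Nat.exists_eq_add_of_le' h.1
  rw [walk_branch hi T h.2.2, walk_one, advance, h.final_eq, h.2.1]
  rfl

theorem walk_ne_none_of_firstReturn_sub {b : ℕ} {r : Config b} {i : Fin b}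
    (hi : r [] = i.castSucc) {T : ℕ} (h : FirstReturn (sub r i) T) {t : ℕ} (h1 : 1 ≤ t)
    (h2 : t ≤ T) : (walk r t).1 ≠ none := by
  rcases t with _ | _ | t
  · omega
  · simp [walk_one]
  · rw [walk_branch hi t fun u hu hu' => h.2.2 u hu (by omega)]
    exact branch_ne_none _ _

theorem firstReturn_add {b : ℕ} {r : Config b} {i : Fin b} (hi : r [] = i.castSucc)
    {T t : ℕ} (h : FirstReturn (sub r i) T) (ht : FirstReturn (advance r i) t) :
    FirstReturn r (T + t) := by
  obtain ⟨t, rfl⟩ := Nat.exists_eq_add_of_le' ht.1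
  refine ⟨by omega, ?_, fun u h1 h2 => ?_⟩
  · rw [walk_add_of_firstReturn_sub hi h]; exact ht.2.1
  · rcases le_or_gt u T with hu | hu
    · exact walk_ne_none_of_firstReturn_sub hi h h1 hu
    · obtain ⟨u, rfl⟩ := Nat.exists_eq_add_of_lt hu
      rw [add_assoc, walk_add_of_firstReturn_sub hi h]
      exact ht.2.2 _ (by omega) (by omega)

theorem escapes_iff_advance {b : ℕ} {r : Config b} {i : Fin b} (hi : r [] = i.castSucc)
    (h : ¬ Escapes (sub r i)) : Escapes r ↔ Escapes (advance r i) := by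
  obtain ⟨T, hT⟩ := (not_not.1 h : Returns _).exists_firstReturn
  refine not_congr ⟨fun hr => ?_, fun hr => ?_⟩
  · obtain ⟨t, h1, h2⟩ := hr
    have hTt : T < t := by
      by_contra hle
      exact walk_ne_none_of_firstReturn_sub hi hT h1 (by omega) h2
    obtain ⟨u, rfl⟩ := Nat.exists_eq_add_of_lt hTt
    rw [add_assoc, walk_add_of_firstReturn_sub hi hT] at h2
    exact ⟨u + 1, by omega, h2⟩
  · obtain ⟨t, ht⟩ := hr.exists_firstReturn
    exact (firstReturn_add hi hT ht).returns

theorem final_of_not_escapes_sub {b : ℕ} {r : Config b} {i : Fin b} (hi : r [] = i.castSucc)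
    (h : ¬ Escapes (sub r i)) : final r = final (advance r i) := by
  obtain ⟨T, hT⟩ := (not_not.1 h : Returns _).exists_firstReturn
  by_cases hr : Escapes (advance r i)
  · funext v
    refine final_apply_of_eventually ((escapes_iff_advance hi h).2 hr) ?_
    rw [← eventually_atTop_add_iff (T + 1)]
    have := (eventually_atTop_add_iff 1).2 (hr.eventually_eq_final v)
    filter_upwards [this] with t ht
    rwa [show t + (T + 1) = T + (t + 1) by ring, walk_add_of_firstReturn_sub hi hT]
  · obtain ⟨t, ht⟩ := (not_not.1 hr : Returns _).exists_firstReturn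
    rw [(firstReturn_add hi hT ht).final_eq, ht.final_eq]
    obtain ⟨t, rfl⟩ := Nat.exists_eq_add_of_le' ht.1
    rw [walk_add_of_firstReturn_sub hi hT]

/-- Excursions into branches are charged to the running time, so that time can serve as an induction
parameter in `levelCount_eq_zero_of_totalTime_le`. -/
theorem retTime_add_le {b : ℕ} {r : Config b} {i : Fin b} (hi : r [] = i.castSucc) :
    retTime (sub r i) + retTime (advance r i) ≤ retTime r := by
  by_cases hr : Escapes r
  · simp [hr.retTime_eq]
  · have h : ¬ Escapes (sub r i) := fun h => hr (escapes_of_sub hi h)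
    have h' : ¬ Escapes (advance r i) := fun h' => hr ((escapes_iff_advance hi h).2 h')
    obtain ⟨T, hT⟩ := (not_not.1 h : Returns _).exists_firstReturn
    obtain ⟨t, ht⟩ := (not_not.1 h' : Returns _).exists_firstReturn
    rw [hT.retTime_eq, ht.retTime_eq, (firstReturn_add hi hT ht).retTime_eq]
    exact_mod_cast le_rfl

/-! ### Recursion for the number of escapes -/

open Classical in
theorem escapeCount_succ {b : ℕ} (r : Config b) (n : ℕ) :
    escapeCount r (n + 1) = escapeCount r n + if Escapes (final^[n] r) then 1 else 0 := by
  simp only [escapeCount, Finset.range_add_one, Finset.filter_insert]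
  split_ifs <;> simp

@[simp] theorem escapeCount_zero {b : ℕ} (r : Config b) : escapeCount r 0 = 0 := by
  simp [escapeCount]

theorem escapeCount_mono {b : ℕ} (r : Config b) : Monotone (escapeCount r) :=
  monotone_nat_of_le_succ fun n => by rw [escapeCount_succ]; exact Nat.le_add_right _ _

theorem escapeCount_le {b : ℕ} (r : Config b) (n : ℕ) : escapeCount r n ≤ n := by
  classical
  exact (Finset.card_filter_le _ _).trans_eq (Finset.card_range n)

/-- The total number of steps of the first `n` particles. -/
noncomputable def totalTime {b : ℕ} (r : Config b) (n : ℕ) : ℕ∞ :=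
  ∑ j ∈ Finset.range n, retTime (final^[j] r)

theorem totalTime_succ {b : ℕ} (r : Config b) (n : ℕ) :
    totalTime r (n + 1) = totalTime r n + retTime (final^[n] r) :=
  Finset.sum_range_succ _ _

theorem totalTime_ne_top {b : ℕ} {r : Config b} {n : ℕ} (h : escapeCount r n = 0) :
    totalTime r n ≠ ⊤ := by
  classical
  induction n with
  | zero => simp [totalTime]
  | succ n ih =>
    rw [escapeCount_succ] at h
    have h2 : ¬ Escapes (final^[n] r) := fun h' => by simp [h'] at h
    rw [totalTime_succ]
    exact WithTop.add_ne_top.2 ⟨ih (by omega), retTime_ne_top h2⟩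

theorem sum_update_add_one {ι M : Type*} [Fintype ι] [DecidableEq ι] [AddCommMonoid M]
    (f : ι → ℕ → M) (N : ι → ℕ) (i : ι) {d : M} (h : f i (N i + 1) = f i (N i) + d) :
    ∑ j, f j (Function.update N i (N i + 1) j) = ∑ j, f j (N j) + d := by
  rw [← Finset.sum_erase_add _ _ (Finset.mem_univ i), ← Finset.sum_erase_add _ _ (Finset.mem_univ i),
    Function.update_self, h, ← add_assoc]
  congr 2
  refine Finset.sum_congr rfl fun j hj => ?_
  rw [Function.update_of_ne (Finset.ne_of_mem_erase hj)]

/-- The configuration `r` arises from `r₀` after `N₀` returns to the root and after `N i` particles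
have been sent to the branch number `i`. -/
def Tracks {b : ℕ} (r₀ r : Config b) (N₀ : ℕ) (N : Fin b → ℕ) : Prop :=
  (∀ i, sub r i = final^[N i] (sub r₀ i)) ∧
    -- The rotor at `[]` passes each child once per revolution; the indicators correct for its
    -- initial and current positions within a revolution.
    ∀ i : Fin b, N i + (if i.succ ≤ r₀ [] then 1 else 0) = N₀ + if i.succ ≤ r [] then 1 else 0

theorem tracks_self {b : ℕ} (r : Config b) : Tracks r r 0 fun _ => 0 :=
  ⟨fun _ => rfl, fun _ => rfl⟩

theorem Tracks.advance {b : ℕ} {r₀ r : Config b} {N₀ : ℕ} {N : Fin b → ℕ} {i : Fin b}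
    (h : Tracks r₀ r N₀ N) (hi : r [] = i.castSucc) :
    Tracks r₀ (advance r i) N₀ (Function.update N i (N i + 1)) := by
  refine ⟨fun j => ?_, fun j => ?_⟩
  · by_cases hj : j = i
    · subst hj
      rw [sub_advance_self, Function.update_self, Function.iterate_succ_apply', h.1]
    · rw [sub_advance_of_ne _ hj, Function.update_of_ne hj, h.1]
  · have := h.2 j
    rw [advance_nil]
    by_cases hj : j = i
    · subst hj
      rw [hi, if_neg (c := j.succ ≤ j.castSucc) (by simp [Fin.le_def])] at this
      rw [Function.update_self, if_pos le_rfl]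
      omega
    · rw [hi] at this
      rw [Function.update_of_ne hj, this]
      have hne : (j : ℕ) ≠ i := fun e => hj (Fin.ext e)
      congr 1
      refine if_congr ?_ rfl rfl
      simp only [Fin.le_def, Fin.val_succ, Fin.val_castSucc]
      omega

-- One particle either escapes through exactly one branch or completes the revolution of the rotor
-- at `[]`. Its time exceeds the time spent in the branches by at least one.
open Classical in
theorem Tracks.exists_final {b : ℕ} {r₀ r : Config b} {N₀ : ℕ} {N : Fin b → ℕ}
    (h : Tracks r₀ r N₀ N) :
    ∃ N', Tracks r₀ (final r) (N₀ + if Escapes r then 0 else 1) N' ∧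
      ∑ i, escapeCount (sub r₀ i) (N' i) =
        ∑ i, escapeCount (sub r₀ i) (N i) + (if Escapes r then 1 else 0) ∧
      ∑ i, totalTime (sub r₀ i) (N' i) + 1 ≤ ∑ i, totalTime (sub r₀ i) (N i) + retTime r := by
  -- Induction on the number of branches still ahead of the rotor in the current revolution.
  induction hd : b - (r [] : ℕ) generalizing r N with
  | zero =>
    have hl : r [] = Fin.last b := by
      have := (r []).isLt
      exact Fin.ext (by rw [Fin.val_last]; omega)
    refine ⟨N, ⟨fun i => ?_, fun i => ?_⟩, ?_, ?_⟩
    · rw [final_of_last hl, sub_update_nil, h.1]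
    · have := h.2 i
      rw [hl, if_pos (Fin.le_last _)] at this
      rw [final_of_last hl, Function.update_self, if_neg (not_escapes_of_last hl), this]
      simp
    · rw [if_neg (not_escapes_of_last hl), add_zero]
    · rw [(firstReturn_of_last hl).retTime_eq]
      gcongr
      norm_num
  | succ d ih =>
    obtain ⟨i, hi⟩ : ∃ i : Fin b, r [] = i.castSucc := by
      refine ⟨⟨r [], by omega⟩, ?_⟩
      ext; simp
    have hA := h.advance hi
    have hT := sum_update_add_one (fun i => totalTime (sub r₀ i)) N i (totalTime_succ _ _)
    have hE := sum_update_add_one (fun i => escapeCount (sub r₀ i)) N i (escapeCount_succ _ _)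
    rw [← h.1 i] at hT hE
    by_cases hs : Escapes (sub r i)
    · have hr := escapes_of_sub hi hs
      refine ⟨Function.update N i (N i + 1), ?_, ?_, ?_⟩
      · rw [final_of_escapes_sub hi hs, if_pos hr]
        exact hA
      · rw [if_pos hr, hE, if_pos hs]
      · rw [hr.retTime_eq]
        simp
    · obtain ⟨N', h1, h2, h3⟩ := ih hA (by
        rw [hi, Fin.val_castSucc] at hd
        rw [advance_nil, Fin.val_succ]
        omega)
      have hiff := escapes_iff_advance hi hs
      refine ⟨N', ?_, ?_, ?_⟩
      · simp only [hiff, final_of_not_escapes_sub hi hs]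
        exact h1
      · rw [h2, hE, if_neg hs]
        simp only [hiff, add_zero]
      · refine h3.trans ?_
        rw [hT, add_assoc]
        gcongr
        exact retTime_add_le hi

theorem exists_tracks {b : ℕ} (r : Config b) (n : ℕ) :
    ∃ N₀ N, Tracks r (final^[n] r) N₀ N ∧ N₀ + escapeCount r n = n ∧
      ∑ i, escapeCount (sub r i) (N i) = escapeCount r n ∧
      ∑ i, totalTime (sub r i) (N i) + n ≤ totalTime r n := by
  classical
  induction n with
  | zero => exact ⟨0, _, tracks_self r, by simp, by simp, by simp [totalTime]⟩
  | succ n ih =>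
    obtain ⟨N₀, N, h, h0, h1, h2⟩ := ih
    obtain ⟨N', h', h1', h2'⟩ := h.exists_final
    refine ⟨N₀ + if Escapes (final^[n] r) then 0 else 1, N', ?_, ?_, ?_, ?_⟩
    · rw [Function.iterate_succ_apply']; exact h'
    · rw [escapeCount_succ]; split_ifs <;> omega
    · rw [h1', h1, escapeCount_succ]
    · rw [totalTime_succ]
      calc ∑ i, totalTime (sub r i) (N' i) + ((n + 1 : ℕ) : ℕ∞)
          = (∑ i, totalTime (sub r i) (N' i) + 1) + n := by push_cast; ring
        _ ≤ (∑ i, totalTime (sub r i) (N i) + retTime (final^[n] r)) + n := by gcongr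
        _ = (∑ i, totalTime (sub r i) (N i) + n) + retTime (final^[n] r) := by ring
        _ ≤ _ := by gcongr

/-- One if the branch number `i` is visited before the first return to the root, that is if the
rotor `k` has not yet passed it. -/
def live {b : ℕ} (k : Fin (b + 1)) (i : Fin b) : ℕ := if k ≤ i.castSucc then 1 else 0

theorem live_le_one {b : ℕ} (k : Fin (b + 1)) (i : Fin b) : live k i ≤ 1 := by
  unfold live; split_ifs <;> simp

theorem live_add {b : ℕ} (k : Fin (b + 1)) (i : Fin b) :
    live k i + (if i.succ ≤ k then 1 else 0) = 1 := by
  unfold live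
  have : i.succ ≤ k ↔ ¬ k ≤ i.castSucc := by
    simp only [Fin.le_def, Fin.val_succ, Fin.val_castSucc]; omega
  by_cases h : k ≤ i.castSucc <;> simp [this, h]

theorem Tracks.le_add_live {b : ℕ} {r₀ r : Config b} {N₀ : ℕ} {N : Fin b → ℕ}
    (h : Tracks r₀ r N₀ N) (i : Fin b) : N i ≤ N₀ + live (r₀ []) i := by
  have h1 := h.2 i
  have h2 := live_add (r₀ []) i
  split_ifs at h1 h2 <;> omega

theorem Tracks.add_live_le {b : ℕ} {r₀ r : Config b} {N₀ : ℕ} {N : Fin b → ℕ}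
    (h : Tracks r₀ r N₀ N) (i : Fin b) : N₀ + live (r₀ []) i ≤ N i + 1 := by
  have h1 := h.2 i
  have h2 := live_add (r₀ []) i
  split_ifs at h1 h2 <;> omega

theorem escapeCount_le_sum {b : ℕ} (r : Config b) (n : ℕ) :
    escapeCount r n ≤
      ∑ i, escapeCount (sub r i) (n - escapeCount r n + live (r []) i) := by
  obtain ⟨N₀, N, h, h0, h1, -⟩ := exists_tracks r n
  conv_lhs => rw [← h1]
  refine Finset.sum_le_sum fun i _ => escapeCount_mono _ ?_
  have := h.le_add_live i
  omega

/-- Lowering the number of returns by at least one absorbs the possible deficit of one visit per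
branch in `Tracks.add_live_le`. -/
theorem sum_le_escapeCount {b : ℕ} (r : Config b) {n m : ℕ} (hm : escapeCount r n < m)
    (hmn : m ≤ n) : ∑ i, escapeCount (sub r i) (n - m + live (r []) i) ≤ escapeCount r n := by
  obtain ⟨N₀, N, h, h0, h1, -⟩ := exists_tracks r n
  rw [← h1]
  refine Finset.sum_le_sum fun i _ => escapeCount_mono _ ?_
  have := h.add_live_le i
  omega

/-! ### Escapes from finite trees -/

/-- The number of the first `n` particles that reach the level `h`, when the particles are stopped
at this level. -/
def levelCount {b : ℕ} : ℕ → Config b → ℕ → ℕ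
  | 0, _, n => n
  | h + 1, r, n =>
    Nat.findGreatest (fun m => m ≤ ∑ i, levelCount h (sub r i) (n - m + live (r []) i)) n

theorem levelCount_le {b : ℕ} (h : ℕ) (r : Config b) (n : ℕ) : levelCount h r n ≤ n := by
  cases h with
  | zero => exact le_rfl
  | succ h => exact Nat.findGreatest_le n

theorem le_levelCount_succ {b : ℕ} {h : ℕ} {r : Config b} {n m : ℕ} (hmn : m ≤ n)
    (hm : m ≤ ∑ i, levelCount h (sub r i) (n - m + live (r []) i)) :
    m ≤ levelCount (h + 1) r n :=
  Nat.le_findGreatest hmn hm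

theorem levelCount_succ_le_sum {b : ℕ} (h : ℕ) (r : Config b) (n : ℕ) :
    levelCount (h + 1) r n ≤
      ∑ i, levelCount h (sub r i) (n - levelCount (h + 1) r n + live (r []) i) :=
  Nat.findGreatest_spec (P := fun m => m ≤ ∑ i, levelCount h (sub r i) (n - m + live (r []) i))
    (Nat.zero_le n) (Nat.zero_le _)

theorem sum_lt_of_levelCount_lt {b : ℕ} {h : ℕ} {r : Config b} {n m : ℕ}
    (hm : levelCount (h + 1) r n < m) (hmn : m ≤ n) :
    ∑ i, levelCount h (sub r i) (n - m + live (r []) i) < m := by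
  by_contra hle
  exact absurd (le_levelCount_succ hmn (not_lt.1 hle)) (by omega)

theorem levelCount_mono {b : ℕ} (h : ℕ) (r : Config b) : Monotone (levelCount h r) := by
  induction h generalizing r with
  | zero => exact monotone_id
  | succ h ih =>
    intro n n' hn
    refine le_levelCount_succ ((levelCount_le _ _ _).trans hn)
      ((levelCount_succ_le_sum h r n).trans (Finset.sum_le_sum fun i _ => ih _ ?_))
    omega

theorem levelCount_succ_le {b : ℕ} (h : ℕ) (r : Config b) (n : ℕ) :
    levelCount (h + 1) r n ≤ levelCount h r n := by
  induction h generalizing r n with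
  | zero => exact levelCount_le _ _ _
  | succ h ih =>
    exact le_levelCount_succ (levelCount_le _ _ _)
      ((levelCount_succ_le_sum _ r n).trans (Finset.sum_le_sum fun i _ => ih _ _))

theorem levelCount_antitone {b : ℕ} (r : Config b) (n : ℕ) :
    Antitone fun h => levelCount h r n :=
  antitone_nat_of_succ_le fun h => levelCount_succ_le h r n

theorem escapeCount_le_levelCount {b : ℕ} (h : ℕ) (r : Config b) (n : ℕ) :
    escapeCount r n ≤ levelCount h r n := by
  induction h generalizing r n with
  | zero => exact escapeCount_le r n
  | succ h ih =>
    exact le_levelCount_succ (escapeCount_le r n)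
      ((escapeCount_le_sum r n).trans (Finset.sum_le_sum fun i _ => ih _ _))

/-- Particles with `s` steps in total cannot get past level `s`. In the induction each particle
spends at least one step outside the branches, so the time available to every branch drops. -/
theorem levelCount_eq_zero_of_totalTime_le {b : ℕ} (s : ℕ) (r : Config b) (n : ℕ)
    (h : totalTime r n ≤ s) : levelCount s r n = 0 := by
  induction s generalizing r n with
  | zero =>
    obtain ⟨N₀, N, -, -, -, h2⟩ := exists_tracks r n
    have : ((n : ℕ) : ℕ∞) ≤ (0 : ℕ) := (le_add_self.trans h2).trans h
    exact Nat.le_zero.1 (by exact_mod_cast this)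
  | succ s ih =>
    rcases Nat.eq_zero_or_pos n with rfl | hn
    · exact Nat.le_zero.1 (levelCount_le _ _ _)
    obtain ⟨N₀, N, ht, h0, h1, h2⟩ := exists_tracks r n
    have hne : totalTime r n ≠ ⊤ := ne_top_of_le_ne_top (ENat.natCast_ne_top _) h
    have hE : escapeCount r n = 0 := by
      classical
      by_contra hE
      obtain ⟨j, hj⟩ := Finset.card_ne_zero.1 hE
      rw [Finset.mem_filter] at hj
      refine hne (top_le_iff.1 ?_)
      rw [← hj.2.retTime_eq]
      exact Finset.single_le_sum (f := fun j => retTime (final^[j] r)) (fun _ _ => zero_le) hj.1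
    have hz : ∀ i, levelCount s (sub r i) (N i) = 0 := by
      intro i
      apply ih
      have h3 : totalTime (sub r i) (N i) + 1 ≤ (s : ℕ∞) + 1 := by
        calc totalTime (sub r i) (N i) + 1
            ≤ ∑ i, totalTime (sub r i) (N i) + n := by
              gcongr
              · exact Finset.single_le_sum (f := fun i => totalTime (sub r i) (N i))
                  (fun _ _ => zero_le) (Finset.mem_univ i)
              · exact_mod_cast hn
          _ ≤ _ := h2.trans (by exact_mod_cast h)
      exact (ENat.add_le_add_iff_right ENat.one_ne_top).1 h3
    by_contra hpos
    have h4 := levelCount_succ_le_sum s r n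
    rw [Finset.sum_eq_zero fun i _ => ?_] at h4
    · omega
    · refine Nat.le_zero.1 ((levelCount_mono s _ ?_).trans_eq (hz i))
      have := ht.add_live_le i
      omega

/-- If nobody escapes, the total time is finite and bounds the level required. Otherwise the
branches receive fewer than `n` particles in the maximality test, and induction on `n` applies. -/
theorem exists_levelCount_eq {b : ℕ} (r : Config b) (n : ℕ) :
    ∃ h, levelCount h r n = escapeCount r n := by
  suffices ∃ h, levelCount h r n ≤ escapeCount r n from
    this.imp fun h hh => le_antisymm hh (escapeCount_le_levelCount h r n)
  induction n using Nat.strong_induction_on generalizing r with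
  | _ n ih =>
    rcases (escapeCount_le r n).eq_or_lt with he | hlt
    · exact ⟨0, he.ge⟩
    rcases Nat.eq_zero_or_pos (escapeCount r n) with h0 | hpos
    · obtain ⟨s, hs⟩ := ENat.ne_top_iff_exists.1 (totalTime_ne_top h0)
      exact ⟨s, (levelCount_eq_zero_of_totalTime_le s r n hs.ge).le.trans (Nat.zero_le _)⟩
    set m := escapeCount r n with hm
    -- Since `m ≥ 1`, the particle number here is below `n` even on a live branch.
    have hi : ∀ i, ∃ h, levelCount h (sub r i) (n - (m + 1) + live (r []) i) ≤
        escapeCount (sub r i) (n - (m + 1) + live (r []) i) := fun i =>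
      ih _ (by have := live_le_one (r []) i; omega) _
    choose g hg using hi
    refine ⟨Finset.univ.sup g + 1, ?_⟩
    by_contra hcon
    rw [not_le] at hcon
    have h1 := levelCount_succ_le_sum (Finset.univ.sup g) r n
    have h2 : ∑ i, levelCount (Finset.univ.sup g) (sub r i)
        (n - levelCount (Finset.univ.sup g + 1) r n + live (r []) i) ≤
        ∑ i, escapeCount (sub r i) (n - (m + 1) + live (r []) i) := by
      refine Finset.sum_le_sum fun i _ => le_trans ?_ (hg i)
      refine (levelCount_antitone _ _ (Finset.le_sup (Finset.mem_univ i))).trans ?_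
      exact levelCount_mono _ _ (by omega)
    have h3 := sum_le_escapeCount r (Nat.lt_succ_self m) hlt
    simp only [Nat.succ_eq_add_one] at h3
    omega

/-! ### The upper bound for the rate of escape -/

theorem levelCount_succ_le_mul_add {b : ℕ} {h : ℕ} {u C : ℝ} (hu : 0 ≤ u)
    (hC : ∀ (r : Config b) (n : ℕ), (levelCount h r n : ℝ) ≤ u * n + C) (r : Config b) (n : ℕ) :
    (levelCount (h + 1) r n : ℝ) ≤ b * u / (1 + b * u) * n + b * (u + C) / (1 + b * u) := by
  have hpos : 0 < 1 + b * u := by positivity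
  have h1 := levelCount_succ_le_sum h r n
  have h2 := levelCount_le (h + 1) r n
  set m := levelCount (h + 1) r n
  have h3 : (m : ℝ) ≤ ∑ _i : Fin b, (u * ((n : ℝ) - m + 1) + C) := by
    calc (m : ℝ) ≤ ((∑ i, levelCount h (sub r i) (n - m + live (r []) i) : ℕ) : ℝ) := by
          exact_mod_cast h1
      _ ≤ _ := by
          push_cast
          refine Finset.sum_le_sum fun i _ => (hC _ _).trans ?_
          gcongr
          have h4 : (live (r []) i : ℝ) ≤ 1 := by exact_mod_cast live_le_one (r []) i
          push_cast [Nat.cast_sub h2]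
          linarith
  simp only [Finset.sum_const, Finset.card_univ, Fintype.card_fin, nsmul_eq_mul] at h3
  rw [div_mul_eq_mul_div, ← add_div, le_div_iff₀ hpos]
  linarith

/-- The rates at which particles reach the level `h` are at most `levelRate b h`. -/
noncomputable def levelRate (b : ℕ) : ℕ → ℝ
  | 0 => 1
  | h + 1 => b * levelRate b h / (1 + b * levelRate b h)

theorem levelRate_pos {b : ℕ} (hb : 2 ≤ b) (h : ℕ) : 0 < levelRate b h := by
  induction h with
  | zero => exact one_pos
  | succ h ih =>
    have : (0 : ℝ) < b := by exact_mod_cast (by omega : 0 < b)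
    unfold levelRate; positivity

/-- Inversion linearises the recursion: the inverse rates satisfy `x ↦ 1 + x / b`. -/
theorem inv_levelRate {b : ℕ} (hb : 2 ≤ b) (h : ℕ) :
    (levelRate b h)⁻¹ = b / (b - 1) - (1 / (b - 1)) * (1 / b) ^ h := by
  have hb' : (2 : ℝ) ≤ b := by exact_mod_cast hb
  have h1 : (b : ℝ) - 1 ≠ 0 := by linarith
  have h0 : (b : ℝ) ≠ 0 := by linarith
  induction h with
  | zero => rw [levelRate]; field_simp
  | succ h ih =>
    have hp := (levelRate_pos hb h).ne'
    have : (levelRate b (h + 1))⁻¹ = 1 + (levelRate b h)⁻¹ / b := by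
      rw [levelRate]; field_simp; ring
    rw [this, ih, pow_succ]
    field_simp
    ring

theorem tendsto_levelRate {b : ℕ} (hb : 2 ≤ b) :
    Tendsto (levelRate b) atTop (𝓝 (((b : ℝ) - 1) / b)) := by
  have hb' : (2 : ℝ) ≤ b := by exact_mod_cast hb
  have h1 : (b : ℝ) - 1 ≠ 0 := by linarith
  have h0 : (b : ℝ) ≠ 0 := by linarith
  have hpow : Tendsto (fun h : ℕ => ((1 : ℝ) / b) ^ h) atTop (𝓝 0) := by
    apply tendsto_pow_atTop_nhds_zero_of_lt_one (by positivity)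
    rw [div_lt_one (by linarith)]; linarith
  have h2 : Tendsto (fun h => (levelRate b h)⁻¹) atTop (𝓝 ((b : ℝ) / (b - 1))) := by
    simp only [inv_levelRate hb]
    simpa using tendsto_const_nhds.sub (hpow.const_mul (1 / ((b : ℝ) - 1)))
  have h3 := h2.inv₀ (div_ne_zero h0 h1)
  simpa using h3

theorem exists_levelCount_le (b : ℕ) (hb : 2 ≤ b) (h : ℕ) :
    ∃ C : ℝ, ∀ (r : Config b) (n : ℕ), (levelCount h r n : ℝ) ≤ levelRate b h * n + C := by
  induction h with
  | zero => exact ⟨0, fun r n => by simp [levelCount, levelRate]⟩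
  | succ h ih =>
    obtain ⟨C, hC⟩ := ih
    exact ⟨_, levelCount_succ_le_mul_add (levelRate_pos hb h).le hC⟩

/-- The proportion of escaping particles is asymptotically at most `(b - 1) / b`. -/
theorem eventually_escapeCount_div_lt {b : ℕ} (hb : 2 ≤ b) (r : Config b) {c : ℝ}
    (hc : ((b : ℝ) - 1) / b < c) : ∀ᶠ n : ℕ in atTop, (escapeCount r n : ℝ) / n < c := by
  obtain ⟨h, hh⟩ := ((tendsto_levelRate hb).eventually (gt_mem_nhds hc)).exists
  obtain ⟨C, hC⟩ := exists_levelCount_le b hb h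
  have h1 : Tendsto (fun n : ℕ => levelRate b h + C / n) atTop (𝓝 (levelRate b h + 0)) :=
    tendsto_const_nhds.add (tendsto_const_div_atTop_nhds_zero_nat C)
  rw [add_zero] at h1
  filter_upwards [h1.eventually (gt_mem_nhds hh), eventually_gt_atTop 0] with n hn hn0
  have hn0' : (0 : ℝ) < n := by exact_mod_cast hn0
  refine lt_of_le_of_lt ?_ hn
  have h2 : (escapeCount r n : ℝ) ≤ levelCount h r n := by
    exact_mod_cast escapeCount_le_levelCount h r n
  rw [div_le_iff₀ hn0', add_mul, div_mul_cancel₀ _ hn0'.ne']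
  exact h2.trans (hC r n)

/-! ### Lower bounds for the rate of escape -/

/-- Up to a bounded error, at least `ℓ * n` of the first `n` particles escape. -/
def RateGE {b : ℕ} (r : Config b) (ℓ : ℝ) : Prop :=
  ∃ C : ℝ, ∀ n : ℕ, ℓ * n ≤ escapeCount r n + C

theorem rateGE_zero {b : ℕ} (r : Config b) : RateGE r 0 := ⟨0, fun n => by simp⟩

/-- With `e` escapes and `s = ∑ i, ℓ i`, the recursion tested at `e + 1` reads `s * (n - e - 1) ≤ e
+ ∑ i, C i`; solve for `e`. The test needs `e < n`, hence the separate case. -/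
theorem RateGE.of_sub {b : ℕ} {r : Config b} {ℓ : Fin b → ℝ} (h0 : ∀ i, 0 ≤ ℓ i)
    (h : ∀ i, RateGE (sub r i) (ℓ i)) : RateGE r ((∑ i, ℓ i) / (1 + ∑ i, ℓ i)) := by
  choose C hC using h
  have hs : 0 ≤ ∑ i, ℓ i := Finset.sum_nonneg fun i _ => h0 i
  have hC0 : ∀ i, 0 ≤ C i := fun i => by simpa using hC i 0
  have hC1 : 0 ≤ ∑ i, C i := Finset.sum_nonneg fun i _ => hC0 i
  refine ⟨(∑ i, ℓ i) + ∑ i, C i, fun n => ?_⟩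
  set s := ∑ i, ℓ i with hsdef
  rw [div_mul_eq_mul_div, div_le_iff₀ (by linarith)]
  rcases (escapeCount_le r n).eq_or_lt with he | hlt
  · rw [he]
    nlinarith [mul_nonneg hs hC1, mul_nonneg hs hs, Nat.cast_nonneg (α := ℝ) n]
  · have h1 := sum_le_escapeCount r (Nat.lt_succ_self _) hlt
    set e := escapeCount r n
    have hle : e + 1 ≤ n := hlt
    have h2 : s * ((n : ℝ) - (e + 1)) ≤ e + ∑ i, C i := by
      calc s * ((n : ℝ) - (e + 1)) = ∑ i, ℓ i * ((n : ℝ) - (e + 1)) := by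
            rw [hsdef, Finset.sum_mul]
        _ ≤ ∑ i, ((escapeCount (sub r i) (n - e.succ + live (r []) i) : ℝ) + C i) := by
            refine Finset.sum_le_sum fun i _ => le_trans ?_ (hC i _)
            gcongr
            · exact h0 i
            · push_cast [Nat.cast_sub hle]
              linarith [Nat.cast_nonneg (α := ℝ) (live (r []) i)]
        _ ≤ e + ∑ i, C i := by
            rw [Finset.sum_add_distrib]
            gcongr
            exact_mod_cast h1
    nlinarith [mul_nonneg hs hC1, mul_nonneg hs hs, Nat.cast_nonneg (α := ℝ) n]

open scoped ENNReal NNReal in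
/-- The lower rate of escape. -/
noncomputable def rate {b : ℕ} (r : Config b) : ℝ≥0∞ :=
  liminf (fun n : ℕ => (escapeCount r n : ℝ≥0∞) / n) atTop

open scoped ENNReal NNReal in
theorem RateGE.le_rate {b : ℕ} {r : Config b} {ℓ : ℝ} (h : RateGE r ℓ) :
    ENNReal.ofReal ℓ ≤ rate r := by
  obtain ⟨C, hC⟩ := h
  refine le_of_forall_lt fun c hc => ?_
  obtain ⟨c', hcc', hc'⟩ := exists_between hc
  refine hcc'.trans_le (le_liminf_of_le (by isBoundedDefault) ?_)
  lift c' to ℝ≥0 using hc'.ne_top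
  have hlt : (c' : ℝ) < ℓ := by
    rw [ENNReal.ofReal, ENNReal.coe_lt_coe] at hc'
    exact Real.lt_toNNReal_iff_coe_lt.1 hc'
  have h1 : Tendsto (fun n : ℕ => ℓ - C / n) atTop (𝓝 (ℓ - 0)) :=
    tendsto_const_nhds.sub (tendsto_const_div_atTop_nhds_zero_nat C)
  rw [sub_zero] at h1
  filter_upwards [h1.eventually (lt_mem_nhds hlt), eventually_gt_atTop 0] with n hn hn0
  have hn0' : (0 : ℝ) < n := by exact_mod_cast hn0
  rw [ENNReal.le_div_iff_mul_le (Or.inl (by exact_mod_cast hn0.ne')) (Or.inl (by simp))]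
  have h2 : (c' : ℝ) * n ≤ escapeCount r n := by
    have h3 := mul_lt_mul_of_pos_right hn hn0'
    rw [sub_mul, div_mul_cancel₀ _ hn0'.ne'] at h3
    linarith [hC n]
  exact_mod_cast h2

open scoped ENNReal NNReal in
theorem rateGE_of_lt_rate {b : ℕ} {r : Config b} {ℓ : ℝ≥0} (h : (ℓ : ℝ≥0∞) < rate r) :
    RateGE r ℓ := by
  obtain ⟨N, hN⟩ := eventually_atTop.1 (eventually_lt_of_lt_liminf h)
  refine ⟨ℓ * (N + 1 : ℕ), fun n => ?_⟩
  rcases lt_or_ge n (N + 1) with hn | hn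
  · have h1 : (ℓ : ℝ) * n ≤ ℓ * (N + 1 : ℕ) := by gcongr
    linarith [Nat.cast_nonneg (α := ℝ) (escapeCount r n)]
  · have h1 := (hN n (by omega)).le
    rw [ENNReal.le_div_iff_mul_le (Or.inl (by exact_mod_cast (by omega : n ≠ 0)))
      (Or.inl (by simp))] at h1
    have h2 : (ℓ : ℝ) * n ≤ escapeCount r n := by exact_mod_cast h1
    have : 0 ≤ (ℓ : ℝ) * (N + 1 : ℕ) := by positivity
    linarith

-- The series-parallel law: conductances `ℓ i` in parallel, followed by a unit resistance. Zero
-- entries are exempt from strictness so that branches may be ignored.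
open scoped ENNReal NNReal in
theorem inv_rate_le_of_sum {b : ℕ} {r : Config b} {ℓ : Fin b → ℝ≥0}
    (h : ∀ i, ℓ i ≠ 0 → (ℓ i : ℝ≥0∞) < rate (sub r i)) (hs : ∑ i, ℓ i ≠ 0) :
    (rate r)⁻¹ ≤ 1 + ((∑ i, ℓ i : ℝ≥0) : ℝ≥0∞)⁻¹ := by
  have h1 : RateGE r ((∑ i, (ℓ i : ℝ)) / (1 + ∑ i, (ℓ i : ℝ))) := by
    refine RateGE.of_sub (fun i => (ℓ i).2) fun i => ?_
    by_cases hi : ℓ i = 0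
    · rw [hi]; exact rateGE_zero _
    · exact rateGE_of_lt_rate (h i hi)
  have h2 := h1.le_rate
  set s := ∑ i, ℓ i with hsdef
  have h3 : (∑ i, (ℓ i : ℝ)) / (1 + ∑ i, (ℓ i : ℝ)) = ((s / (1 + s) : ℝ≥0) : ℝ) := by
    rw [hsdef]; push_cast; rfl
  rw [h3, ENNReal.ofReal_coe_nnreal] at h2
  refine (ENNReal.inv_le_inv.2 h2).trans_eq ?_
  have hne : s / (1 + s) ≠ 0 := div_ne_zero hs (by positivity)
  rw [← ENNReal.coe_inv hne, ← ENNReal.coe_inv hs, ← ENNReal.coe_one, ← ENNReal.coe_add]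
  congr 1
  rw [inv_div, add_div, div_self hs, one_div, add_comm]

open scoped ENNReal NNReal in
theorem inv_rate_le_one_add {b : ℕ} (r : Config b) (i : Fin b) :
    (rate r)⁻¹ ≤ 1 + (rate (sub r i))⁻¹ := by
  rw [add_comm, ← tsub_le_iff_right]
  refine le_of_forall_gt fun y hy => ?_
  obtain ⟨y', hy1, hy2⟩ := exists_between hy
  lift y' to ℝ≥0 using hy2.ne_top
  have hy0 : y' ≠ 0 := by rintro rfl; simp at hy1
  have h1 : ((y'⁻¹ : ℝ≥0) : ℝ≥0∞) < rate (sub r i) := by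
    rw [ENNReal.coe_inv hy0]; exact ENNReal.inv_lt_iff_inv_lt.1 hy1
  have h2 := inv_rate_le_of_sum (r := r) (ℓ := fun j => if j = i then y'⁻¹ else 0)
    (fun j hj => by
      by_cases hji : j = i
      · subst hji; simpa using h1
      · simp [hji] at hj) (by simp [hy0])
  simp only [Finset.sum_ite_eq', Finset.mem_univ, if_true] at h2
  rw [ENNReal.coe_inv hy0, inv_inv] at h2
  refine lt_of_le_of_lt ?_ hy2
  rw [tsub_le_iff_right, add_comm]
  exact h2

-- The harmonic mean of the branch resistances is at most their arithmetic mean, by Cauchy-Schwarz.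
open scoped ENNReal NNReal in
theorem inv_rate_le_one_add_sum {b : ℕ} (hb : b ≠ 0) (r : Config b) :
    (rate r)⁻¹ ≤ 1 + (∑ i, (rate (sub r i))⁻¹) / (b : ℝ≥0∞) ^ 2 := by
  have : Nonempty (Fin b) := ⟨⟨0, Nat.pos_of_ne_zero hb⟩⟩
  by_cases htop : ∃ i, (rate (sub r i))⁻¹ = ⊤
  · obtain ⟨i, hi⟩ := htop
    have : ∑ i, (rate (sub r i))⁻¹ = ⊤ := ENNReal.sum_eq_top.2 ⟨i, Finset.mem_univ _, hi⟩
    rw [this, ENNReal.top_div_of_ne_top (by simp)]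
    simp
  push Not at htop
  -- The slack `ε` makes the chosen conductances strictly smaller than the branch rates, which are
  -- only lower limits.
  have key : ∀ ε : ℝ≥0, 0 < ε → (rate r)⁻¹ ≤
      1 + (∑ i, ((rate (sub r i))⁻¹ + ε)) / (b : ℝ≥0∞) ^ 2 := by
    intro ε hε
    set y : Fin b → ℝ≥0 := fun i => ((rate (sub r i))⁻¹).toNNReal + ε with hy
    have hyE : ∀ i, ((rate (sub r i))⁻¹ + ε : ℝ≥0∞) = y i := fun i => by
      simp only [hy, ENNReal.coe_add, ENNReal.coe_toNNReal (htop i)]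
    have hy0 : ∀ i, 0 < y i := fun i => by simp only [hy]; positivity
    have hs0 : 0 < ∑ i, (y i)⁻¹ :=
      Finset.sum_pos (fun i _ => inv_pos.2 (hy0 i)) Finset.univ_nonempty
    refine (inv_rate_le_of_sum (ℓ := fun i => (y i)⁻¹) (fun i _ => ?_) hs0.ne').trans ?_
    · rw [ENNReal.coe_inv (hy0 i).ne', ENNReal.inv_lt_iff_inv_lt, ← hyE]
      exact ENNReal.lt_add_right (htop i) (by exact_mod_cast hε.ne')
    · gcongr
      simp only [hyE]
      rw [← ENNReal.coe_inv hs0.ne', ← ENNReal.ofNNReal_finsetSum, ← ENNReal.coe_natCast,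
        ← ENNReal.coe_pow, ← ENNReal.coe_div (by positivity), ENNReal.coe_le_coe,
        le_div_iff₀ (by positivity), inv_mul_le_iff₀ hs0]
      have := Finset.sum_sq_le_sum_mul_sum_of_sq_le_mul Finset.univ (r := fun _ : Fin b => (1 : ℝ≥0))
        (f := fun i => (y i)⁻¹) (g := y) (fun _ _ => zero_le) (fun _ _ => zero_le)
        (fun i _ => by rw [inv_mul_cancel₀ (hy0 i).ne', one_pow])
      simpa using this
  refine ENNReal.le_of_forall_pos_le_add fun ε hε _ => (key ε hε).trans ?_
  rw [Finset.sum_add_distrib, ENNReal.add_div, add_assoc]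
  gcongr
  simp only [Finset.sum_const, Finset.card_univ, Fintype.card_fin, nsmul_eq_mul]
  have hb1 : (1 : ℝ≥0∞) ≤ b := by exact_mod_cast Nat.pos_of_ne_zero hb
  refine ENNReal.div_le_of_le_mul ?_
  rw [mul_comm, sq]
  gcongr
  exact le_mul_of_one_le_left (by simp) hb1

theorem rate_le {b : ℕ} (hb : 2 ≤ b) (r : Config b) :
    rate r ≤ ENNReal.ofReal (((b : ℝ) - 1) / b) := by
  have hb' : (2 : ℝ) ≤ b := by exact_mod_cast hb
  have h0 : 0 ≤ ((b : ℝ) - 1) / b := div_nonneg (by linarith) (by linarith)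
  refine le_of_forall_gt fun c hc => ?_
  obtain ⟨c', hc', hcc'⟩ := exists_between hc
  refine lt_of_le_of_lt ?_ hcc'
  lift c' to NNReal using hcc'.ne_top
  have hlt : ((b : ℝ) - 1) / b < c' := (ENNReal.ofReal_lt_coe_iff h0).1 hc'
  refine liminf_le_of_frequently_le' (Eventually.frequently ?_)
  filter_upwards [eventually_escapeCount_div_lt hb r hlt, eventually_gt_atTop 0] with n hn hn0
  have hn0' : (0 : ℝ) < n := by exact_mod_cast hn0
  refine ENNReal.div_le_of_le_mul ?_
  rw [div_lt_iff₀ hn0'] at hn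
  exact_mod_cast hn.le

theorem tendsto_of_le_rate {b : ℕ} (hb : 2 ≤ b) (r : Config b)
    (h : ENNReal.ofReal (((b : ℝ) - 1) / b) ≤ rate r) :
    Tendsto (fun n : ℕ => (escapeCount r n : ℝ) / n) atTop (𝓝 (((b : ℝ) - 1) / b)) := by
  refine tendsto_order.2 ⟨fun c hc => ?_, fun c hc => eventually_escapeCount_div_lt hb r hc⟩
  rcases lt_or_ge c 0 with hneg | hc0
  · exact Eventually.of_forall fun n => hneg.trans_le (by positivity)
  have h1 : ENNReal.ofReal c < rate r := ((ENNReal.ofReal_lt_ofReal_iff_of_nonneg hc0).2 hc).trans_le h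
  filter_upwards [eventually_lt_of_lt_liminf h1, eventually_gt_atTop 0] with n hn hn0
  have hn0' : (0 : ℝ) < n := by exact_mod_cast hn0
  have h2 : (escapeCount r n : ENNReal) / n = ENNReal.ofReal ((escapeCount r n : ℝ) / n) := by
    rw [ENNReal.ofReal_div_of_pos hn0', ENNReal.ofReal_natCast, ENNReal.ofReal_natCast]
  rw [h2] at hn
  exact (ENNReal.ofReal_lt_ofReal_iff_of_nonneg hc0).1 hn

/-! ### Flows on the live vertices -/

/-- The number of vertices of level `h` that are connected to `[]` by live edges, divided by
`m ^ h`. -/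
noncomputable def flow {b : ℕ} (m : ℝ) : ℕ → Config b → ℝ
  | 0, _ => 1
  | h + 1, r => m⁻¹ * ∑ i, (live (r []) i : ℝ) * flow m h (sub r i)

/-- The energy of the flow of strength `flow m h r` that is uniform on the vertices of level `h`
connected to `[]` by live edges. -/
noncomputable def energy {b : ℕ} (m : ℝ) : ℕ → Config b → ℝ
  | 0, _ => 1
  | h + 1, r =>
    flow m (h + 1) r ^ 2 + m⁻¹ ^ 2 * ∑ i, (live (r []) i : ℝ) * energy m h (sub r i)

theorem energy_nonneg {b : ℕ} {m : ℝ} (h : ℕ) (r : Config b) : 0 ≤ energy m h r := by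
  induction h generalizing r with
  | zero => exact zero_le_one
  | succ h ih =>
    exact add_nonneg (sq_nonneg _) (mul_nonneg (sq_nonneg _)
      (Finset.sum_nonneg fun i _ => mul_nonneg (by simp) (ih _)))

theorem sq_flow_le_energy {b : ℕ} {m : ℝ} (h : ℕ) (r : Config b) :
    flow m h r ^ 2 ≤ energy m h r := by
  cases h with
  | zero => simp [flow, energy]
  | succ h =>
    exact le_add_of_nonneg_right (mul_nonneg (sq_nonneg _)
      (Finset.sum_nonneg fun i _ => mul_nonneg (by simp) (energy_nonneg _ _)))

/-- A discrete Thomson principle: flow squared over energy bounds the conductance from below.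
Cauchy-Schwarz combines the branches, and there is no additive error, so the bound survives `h → ∞`.
-/
theorem mul_sq_flow_le {b : ℕ} (m : ℝ) (h : ℕ) (r : Config b) (n : ℕ) :
    n * flow m h r ^ 2 ≤ levelCount h r n * energy m h r := by
  induction h generalizing r n with
  | zero => simp [flow, energy, levelCount]
  | succ h ih =>
    rcases (levelCount_le (h + 1) r n).eq_or_lt with he | hlt
    · rw [he]
      exact mul_le_mul_of_nonneg_left (sq_flow_le_energy _ _) (by simp)
    have h1 := Nat.le_of_lt_succ (sum_lt_of_levelCount_lt (Nat.lt_succ_self _) hlt)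
    set k := levelCount (h + 1) r n
    have hkn : (0 : ℝ) ≤ (n : ℝ) - k := by
      rw [sub_nonneg]; exact_mod_cast hlt.le
    have h2 : ((n : ℝ) - k) * (∑ i, (live (r []) i : ℝ) * flow m h (sub r i)) ^ 2 ≤
        k * ∑ i, (live (r []) i : ℝ) * energy m h (sub r i) := by
      set f : Fin b → ℝ := fun i => levelCount h (sub r i) (n - (k + 1) + live (r []) i)
      have hf : ∑ i, f i ≤ k := by simp only [f]; exact_mod_cast h1
      have h3 := Finset.sum_sq_le_sum_mul_sum_of_sq_le_mul Finset.univ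
        (r := fun i => √((n : ℝ) - k) * ((live (r []) i : ℝ) * flow m h (sub r i))) (f := f)
        (g := fun i => (live (r []) i : ℝ) * energy m h (sub r i)) (fun _ _ => by positivity)
        (fun i _ => mul_nonneg (by simp) (energy_nonneg _ _)) (fun i _ => by
          simp only [mul_pow, Real.sq_sqrt hkn, f]
          rcases Nat.le_one_iff_eq_zero_or_eq_one.1 (live_le_one (r []) i) with hl | hl
          · simp [hl]
          · have h4 := ih (sub r i) (n - (k + 1) + live (r []) i)
            -- On a live branch the extra visit cancels exactly the loss of one; this is why the
            -- flow uses live edges only.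
            have h5 : n - (k + 1) + live (r []) i = n - k := by omega
            rw [h5, Nat.cast_sub hlt.le] at h4
            rw [h5, hl]
            simpa using h4)
      rw [← Finset.mul_sum, mul_pow, Real.sq_sqrt hkn] at h3
      exact h3.trans (mul_le_mul_of_nonneg_right hf
        (Finset.sum_nonneg fun i _ => mul_nonneg (by simp) (energy_nonneg _ _)))
    have h6 := mul_le_mul_of_nonneg_left h2 (sq_nonneg m⁻¹)
    have h7 : flow m (h + 1) r ^ 2 =
        m⁻¹ ^ 2 * (∑ i, (live (r []) i : ℝ) * flow m h (sub r i)) ^ 2 := by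
      rw [flow, mul_pow]
    rw [energy, h7]
    linarith

/-! ### Product measures -/

/-- A product measure splits into one factor and the product of the remaining ones. -/
theorem map_infinitePi_option {ι κ X : Type*} [MeasurableSpace X] (μ : Measure X)
    [IsProbabilityMeasure μ] (e : Option κ ≃ ι) :
    (Measure.infinitePi fun _ : ι => μ).map (fun f => (f (e none), fun k => f (e (some k)))) =
      μ.prod (Measure.infinitePi fun _ : κ => μ) := by
  classical
  set G : X × (κ → X) → ι → X := fun p i => (e.symm i).elim p.1 p.2 with hG
  have hGm : Measurable G := by
    refine measurable_pi_lambda _ fun i => ?_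
    simp only [hG]
    cases e.symm i with
    | none => exact measurable_fst
    | some k => exact (measurable_pi_apply k).comp measurable_snd
  -- `G` inverts the splitting map; it suffices to identify its image measure on finite cylinders.
  have hmap : (μ.prod (Measure.infinitePi fun _ : κ => μ)).map G =
      Measure.infinitePi fun _ : ι => μ := by
    refine Measure.eq_infinitePi _ fun s t ht => ?_
    set s' : Finset (Option κ) := s.map e.symm.toEmbedding with hs'
    have hpre : G ⁻¹' (Set.pi s t) = (if none ∈ s' then t (e none) else Set.univ) ×ˢ
        Set.pi (Finset.eraseNone s') (fun k => t (e (some k))) := by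
      ext p
      simp only [Set.mem_preimage, Set.mem_pi, Finset.mem_coe, Set.mem_prod,
        Finset.mem_eraseNone]
      have hmem : ∀ o, o ∈ s' ↔ e o ∈ s := fun o => by
        simp [hs']
      constructor
      · intro h
        refine ⟨?_, fun k hk => ?_⟩
        · split_ifs with hn
          · simpa [hG] using h _ ((hmem _).1 hn)
          · trivial
        · simpa [hG] using h _ ((hmem _).1 hk)
      · rintro ⟨h1, h2⟩ i hi
        obtain ⟨o, rfl⟩ := e.surjective i
        cases o with
        | none =>
          rw [if_pos ((hmem _).2 hi)] at h1
          simpa [hG] using h1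
        | some k => simpa [hG] using h2 k ((hmem _).2 hi)
    rw [Measure.map_apply hGm (.pi s.countable_toSet fun _ _ => ht _), hpre, Measure.prod_prod,
      Measure.infinitePi_pi _ fun k _ => ht _]
    have hprod : ∏ i ∈ s, μ (t i) = ∏ o ∈ s', μ (t (e o)) := by
      simp [hs']
    rw [hprod]
    by_cases hn : none ∈ s'
    · rw [if_pos hn, ← Finset.mul_prod_erase _ _ hn, ← Finset.map_some_eraseNone, Finset.prod_map]
      rfl
    · rw [if_neg hn, measure_univ, one_mul]
      conv_rhs => rw [← Finset.erase_eq_of_notMem hn, ← Finset.map_some_eraseNone, Finset.prod_map]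
      rfl
  rw [← hmap, Measure.map_map (by fun_prop) hGm]
  convert Measure.map_id
  ext p <;> simp [hG]

/-- The words are the empty word and the words with a last letter. -/
def wordEquiv (b : ℕ) : Option (Fin b × List (Fin b)) ≃ List (Fin b) where
  toFun o := o.elim [] fun p => p.2 ++ [p.1]
  invFun u := u.getLast?.map fun i => (i, u.dropLast)
  left_inv o := by cases o <;> simp
  right_inv u := by
    rcases List.eq_nil_or_concat u with rfl | ⟨w, j, rfl⟩ <;> simp

/-- The law of a configuration of independent rotors with law `μ`. -/
noncomputable abbrev law (b : ℕ) (μ : Measure (Fin (b + 1))) : Measure (Config b) :=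
  Measure.infinitePi fun _ => μ

theorem map_law (b : ℕ) (μ : Measure (Fin (b + 1))) [IsProbabilityMeasure μ] :
    (law b μ).map (fun r => (r [], fun i => sub r i)) =
      μ.prod (Measure.pi fun _ : Fin b => law b μ) := by
  have h1 := map_infinitePi_option μ (wordEquiv b)
  have h2 := Measure.infinitePi_map_curry (fun (_ : Fin b) (_ : List (Fin b)) => μ)
  rw [Measure.infinitePi_eq_pi (ι := Fin b)] at h2
  have h3 := congrArg (Measure.map (Prod.map id
    (MeasurableEquiv.curry (Fin b) (List (Fin b)) (Fin (b + 1))))) h1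
  rw [Measure.map_map (by fun_prop) (by fun_prop),
    ← Measure.map_prod_map _ _ measurable_id (by fun_prop), Measure.map_id, h2] at h3
  exact h3

theorem measurable_sub {b : ℕ} (i : Fin b) : Measurable fun r : Config b => sub r i :=
  measurable_pi_lambda _ fun _ => measurable_pi_apply _

theorem measurePreserving_split (b : ℕ) (μ : Measure (Fin (b + 1))) [IsProbabilityMeasure μ] :
    MeasurePreserving (fun r : Config b => (r [], fun i => sub r i)) (law b μ)
      (μ.prod (Measure.pi fun _ : Fin b => law b μ)) :=
  ⟨(measurable_pi_apply _).prodMk (measurable_pi_lambda _ measurable_sub), map_law b μ⟩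

theorem measurePreserving_sub {b : ℕ} (μ : Measure (Fin (b + 1))) [IsProbabilityMeasure μ]
    (i : Fin b) : MeasurePreserving (fun r : Config b => sub r i) (law b μ) (law b μ) :=
  ((measurePreserving_eval (fun _ : Fin b => law b μ) i).comp
    measurePreserving_snd).comp (measurePreserving_split b μ)

theorem law_inter_sub {b : ℕ} (μ : Measure (Fin (b + 1))) [IsProbabilityMeasure μ]
    (A : Set (Fin (b + 1))) {B : Fin b → Set (Config b)} (hB : ∀ i, MeasurableSet (B i)) :
    law b μ {r | r [] ∈ A ∧ ∀ i, sub r i ∈ B i} = μ A * ∏ i, law b μ (B i) := by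
  have h := (measurePreserving_split b μ).measure_preimage (s := A ×ˢ Set.univ.pi B)
    ((MeasurableSet.of_discrete.prod (MeasurableSet.univ_pi hB)).nullMeasurableSet)
  rw [Measure.prod_prod, Measure.pi_pi] at h
  rw [← h]
  congr 1
  ext r
  simp

/-! ### Measurability -/

theorem measurable_levelCount {b : ℕ} (h n : ℕ) :
    Measurable fun r : Config b => levelCount h r n := by
  induction h generalizing n with
  | zero => exact measurable_const
  | succ h ih =>
    refine measurable_findGreatest fun k _ => measurableSet_le measurable_const ?_
    refine Finset.measurable_sum _ fun i _ => ?_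
    have h1 : Measurable fun p : Config b × ℕ => levelCount h p.1 p.2 :=
      measurable_from_prod_countable_left ih
    refine h1.comp ((measurable_sub i).prodMk ?_)
    exact (Measurable.of_discrete (f := fun k => n - _ + live k i)).comp (measurable_pi_apply [])

/-- Escaping involves infinitely many steps, but the count is the attained infimum over `h` of the
recursively defined `levelCount h`. -/
theorem measurable_escapeCount {b : ℕ} (n : ℕ) :
    Measurable fun r : Config b => escapeCount r n := by
  refine measurable_of_Iic fun k => ?_
  have : (fun r : Config b => escapeCount r n) ⁻¹' Set.Iic k =
      ⋃ h, {r | levelCount h r n ≤ k} := by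
    ext r
    simp only [Set.mem_preimage, Set.mem_Iic, Set.mem_iUnion, Set.mem_ofPred_eq]
    constructor
    · intro hr
      obtain ⟨h, hh⟩ := exists_levelCount_eq r n
      exact ⟨h, hh.trans_le hr⟩
    · rintro ⟨h, hh⟩
      exact (escapeCount_le_levelCount h r n).trans hh
  rw [this]
  exact MeasurableSet.iUnion fun h => measurableSet_le (measurable_levelCount h n) measurable_const

theorem measurable_rate {b : ℕ} : Measurable fun r : Config b => rate r := by
  refine Measurable.liminf fun n => ?_
  exact ((Measurable.of_discrete (f := fun k : ℕ => (k : ENNReal))).comp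
    (measurable_escapeCount n)).div_const _

theorem measurable_live {b : ℕ} (i : Fin b) :
    Measurable fun r : Config b => (live (r []) i : ℝ) :=
  (Measurable.of_discrete (f := fun k => (live k i : ℝ))).comp (measurable_pi_apply [])

theorem measurable_flow {b : ℕ} (m : ℝ) (h : ℕ) :
    Measurable fun r : Config b => flow m h r := by
  induction h with
  | zero => exact measurable_const
  | succ h ih =>
    exact (Finset.measurable_sum _ fun i _ =>
      (measurable_live i).mul (ih.comp (measurable_sub i))).const_mul _

theorem measurable_energy {b : ℕ} (m : ℝ) (h : ℕ) :
    Measurable fun r : Config b => energy m h r := by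
  induction h with
  | zero => exact measurable_const
  | succ h ih =>
    exact ((measurable_flow m (h + 1)).pow_const 2).add ((Finset.measurable_sum _ fun i _ =>
      (measurable_live i).mul (ih.comp (measurable_sub i))).const_mul _)

/-! ### No escapes for large rotors -/

/-- The offspring generating function lies above its tangent at `1`, of slope `b - ∑ k, p k * k ≤
1`, hence above the diagonal on `[0, 1]`. Touching the diagonal at `q < 1` would force exactly one
child almost surely. -/
theorem eq_one_of_sum_pow_le {b : ℕ} {p : Fin (b + 1) → ℝ} (hp : ∀ k, 0 ≤ p k)
    (hp1 : ∑ k, p k = 1) (hmean : (b : ℝ) - 1 ≤ ∑ k, p k * (k : ℕ)) (hnd : ∀ k, p k ≠ 1)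
    {q : ℝ} (hq0 : 0 ≤ q) (hq1 : q ≤ 1) (hq : ∑ k, p k * q ^ (b - (k : ℕ)) ≤ q) : q = 1 := by
  by_contra hne
  have hlt : q < 1 := lt_of_le_of_ne hq1 hne
  have hB : ∀ N : ℕ, 1 - N * (1 - q) ≤ q ^ N := fun N => by
    have := one_add_mul_le_pow (a := q - 1) (by linarith) N
    rw [add_sub_cancel] at this
    linarith
  have hcast : ∀ k : Fin (b + 1), ((b - (k : ℕ) : ℕ) : ℝ) = b - (k : ℕ) := fun k => by
    rw [Nat.cast_sub (Nat.lt_succ_iff.1 k.isLt)]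
  have hsum : ∑ k, p k * (1 - (b - (k : ℕ) : ℕ) * (1 - q)) =
      1 - (1 - q) * (b - ∑ k, p k * (k : ℕ)) := by
    have : ∀ k : Fin (b + 1), p k * (1 - (b - (k : ℕ) : ℕ) * (1 - q)) =
        p k * (1 - b * (1 - q)) + (p k * (k : ℕ)) * (1 - q) := fun k => by rw [hcast]; ring
    simp only [this, Finset.sum_add_distrib, ← Finset.sum_mul, hp1]
    ring
  have hle : ∀ k ∈ Finset.univ, p k * (1 - (b - (k : ℕ) : ℕ) * (1 - q)) ≤
      p k * q ^ (b - (k : ℕ)) := fun k _ => mul_le_mul_of_nonneg_left (hB _) (hp k)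
  have hge : q ≤ ∑ k, p k * (1 - (b - (k : ℕ) : ℕ) * (1 - q)) := by
    rw [hsum]; nlinarith
  have heq := (Finset.sum_eq_sum_iff_of_le hle).1
    (le_antisymm (Finset.sum_le_sum hle) (hq.trans hge))
  -- Bernoulli's inequality is strict for exponents at least two when `q < 1`.
  have hzero : ∀ k : Fin (b + 1), 2 ≤ b - (k : ℕ) → p k = 0 := by
    intro k hk
    by_contra hpk
    have h1 := mul_left_cancel₀ hpk (heq k (Finset.mem_univ k))
    obtain ⟨N, hN⟩ := Nat.exists_eq_add_of_le' hk
    rw [hN] at h1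
    have h2 := hB (N + 1)
    have h3 : q ^ (N + 2) = q * q ^ (N + 1) := by ring
    rw [h3] at h1
    have h4 := mul_le_mul_of_nonneg_left h2 hq0
    push_cast at h1 h4
    nlinarith [mul_pos (sub_pos.2 hlt) (sub_pos.2 hlt), Nat.cast_nonneg (α := ℝ) N,
      mul_nonneg (Nat.cast_nonneg (α := ℝ) N) (mul_pos (sub_pos.2 hlt) (sub_pos.2 hlt)).le]
  have hmean2 : (b : ℝ) - ∑ k, p k * (k : ℕ) ≥ 1 := by
    have h1 := hge
    have h2 : ∑ k, p k * (1 - (b - (k : ℕ) : ℕ) * (1 - q)) ≤ q := (Finset.sum_le_sum hle).trans hq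
    rw [hsum] at h2
    nlinarith
  have h5 : ∑ k, p k * ((b : ℝ) - (k : ℕ)) = (b : ℝ) - ∑ k, p k * (k : ℕ) := by
    simp only [mul_sub, Finset.sum_sub_distrib, ← Finset.sum_mul, hp1, one_mul]
  have h6 : ∑ k, p k * (1 - ((b : ℝ) - (k : ℕ))) ≤ 0 := by
    simp only [mul_sub _ (1 : ℝ) _, mul_one, Finset.sum_sub_distrib, hp1, h5]
    linarith
  have h7 : ∀ k ∈ Finset.univ, 0 ≤ p k * (1 - ((b : ℝ) - (k : ℕ))) := by
    intro k _
    rcases le_or_gt 2 (b - (k : ℕ)) with h | h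
    · rw [hzero k h, zero_mul]
    · refine mul_nonneg (hp k) ?_
      rw [← hcast]
      have : ((b - (k : ℕ) : ℕ) : ℝ) ≤ 1 := by exact_mod_cast (by omega : b - (k : ℕ) ≤ 1)
      linarith
  have h8 := (Finset.sum_eq_zero_iff_of_nonneg h7).1 (le_antisymm h6 (Finset.sum_nonneg h7))
  have hone : ∀ k : Fin (b + 1), b - (k : ℕ) ≠ 1 → p k = 0 := by
    intro k hk
    have h9 := h8 k (Finset.mem_univ k)
    rcases mul_eq_zero.1 h9 with h | h
    · exact h
    · rw [← hcast, sub_eq_zero] at h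
      exact absurd (by exact_mod_cast h.symm) hk
  obtain ⟨k, hk⟩ : ∃ k : Fin (b + 1), b - (k : ℕ) = 1 := by
    by_contra hcon
    push Not at hcon
    rw [Finset.sum_eq_zero fun k _ => hone k (hcon k)] at hp1
    exact zero_ne_one hp1
  refine hnd k ?_
  rw [← hp1]
  refine (Finset.sum_eq_single k (fun j _ hj => hone j fun hj1 => hj ?_) (by simp)).symm
  ext; omega

theorem card_live {b : ℕ} (k : Fin (b + 1)) :
    (Finset.univ.filter fun i : Fin b => k ≤ i.castSucc).card = b - (k : ℕ) := by
  have := Fin.card_filter_val_lt (n := b) (m := k)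
  have h2 := Finset.card_filter_add_card_filter_not (s := (Finset.univ : Finset (Fin b)))
    (fun i => (i : ℕ) < k)
  simp only [Finset.card_univ, Fintype.card_fin, not_lt] at h2
  simp only [Fin.le_def, Fin.val_castSucc]
  have := k.isLt
  omega

/-- If one of `n + 1` particles escapes, a live branch sees at most `n + 1` particles and any other
branch at most `n`, where induction excludes escapes. So the probability `q` of no escape satisfies
`∑ k, p k * q ^ (b - k) ≤ q`. -/
theorem ae_escapeCount_eq_zero {b : ℕ} (μ : Measure (Fin (b + 1))) [IsProbabilityMeasure μ]
    (hnd : ∀ k, μ.real {k} ≠ 1) (hmean : (b : ℝ) - 1 ≤ ∑ k, μ.real {k} * ((k : ℕ) : ℝ)) (n : ℕ) :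
    ∀ᵐ r ∂(law b μ), escapeCount r n = 0 := by
  induction n with
  | zero => simp
  | succ n ih =>
    set S : Set (Config b) := {r | escapeCount r (n + 1) = 0} with hS
    have hSm : MeasurableSet S := measurable_escapeCount (n + 1) (measurableSet_singleton 0)
    have hae : ∀ᵐ r ∂(law b μ), ∀ i, escapeCount (sub r i) n = 0 :=
      ae_all_iff.2 fun i => (measurePreserving_sub μ i).quasiMeasurePreserving.ae ih
    set B : Fin (b + 1) → Fin b → Set (Config b) :=
      fun k i => if k ≤ i.castSucc then S else Set.univ with hB
    have hBm : ∀ k i, MeasurableSet (B k i) := fun k i => by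
      simp only [hB]; split_ifs <;> simp [hSm]
    have hsub : (⋃ k, {r : Config b | r [] ∈ ({k} : Set (Fin (b + 1))) ∧ ∀ i, sub r i ∈ B k i})
        ≤ᵐ[law b μ] S := by
      filter_upwards [hae] with r hr hmem
      obtain ⟨k, hk, hi⟩ := Set.mem_iUnion.1 hmem
      by_contra hne
      have hpos : 1 ≤ escapeCount r (n + 1) := Nat.one_le_iff_ne_zero.2 hne
      have h1 := escapeCount_le_sum r (n + 1)
      rw [Finset.sum_eq_zero fun i _ => ?_] at h1
      · omega
      · have hii := hi i
        rw [Set.mem_singleton_iff] at hk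
        simp only [hB, ← hk] at hii
        unfold live
        by_cases hl : r [] ≤ i.castSucc
        · rw [if_pos hl] at hii
          rw [if_pos hl]
          exact Nat.le_zero.1 ((escapeCount_mono _ (by omega)).trans_eq hii)
        · rw [if_neg hl]
          exact Nat.le_zero.1 ((escapeCount_mono _ (by omega)).trans_eq (hr i))
    have hEm : ∀ k, MeasurableSet
        {r : Config b | r [] ∈ ({k} : Set (Fin (b + 1))) ∧ ∀ i, sub r i ∈ B k i} := fun k => by
      have h := (measurePreserving_split b μ).measurable
        ((measurableSet_singleton k).prod (MeasurableSet.univ_pi (hBm k)))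
      convert h using 1
      ext r
      simp
    have hle := measure_mono_ae hsub
    rw [measure_iUnion (fun k k' hkk' => by
        refine Set.disjoint_left.2 fun r hr hr' => hkk' ?_
        exact (Set.mem_singleton_iff.1 hr.1).symm.trans (Set.mem_singleton_iff.1 hr'.1))
      hEm, tsum_fintype] at hle
    simp only [law_inter_sub μ _ (hBm _)] at hle
    have hprod : ∀ k, ∏ i, law b μ (B k i) = law b μ S ^ (b - (k : ℕ)) := by
      intro k
      have : ∀ i, law b μ (B k i) = if k ≤ i.castSucc then law b μ S else 1 := fun i => by
        simp only [hB]; split_ifs <;> simp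
      simp only [this, Finset.prod_ite, Finset.prod_const, one_pow, mul_one, card_live]
    simp only [hprod] at hle
    have hq := ENNReal.toReal_mono (measure_ne_top _ _) hle
    rw [ENNReal.toReal_sum (fun k _ => by finiteness)] at hq
    simp only [ENNReal.toReal_mul, ENNReal.toReal_pow] at hq
    have hone := eq_one_of_sum_pow_le (p := fun k => μ.real {k}) (fun k => measureReal_nonneg)
      (by rw [sum_measureReal_singleton]; simp) hmean hnd ENNReal.toReal_nonneg
      (measureReal_le_one (μ := law b μ)) hq
    have : law b μ S = 1 := by
      rw [← ENNReal.ofReal_toReal (measure_ne_top (law b μ) S), hone, ENNReal.ofReal_one]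
    exact (prob_compl_eq_zero_iff hSm).2 this

/-! ### A positive rate of escape with positive probability -/

theorem exists_flow_le (b : ℕ) (m : ℝ) (h : ℕ) :
    ∃ C : ℝ, ∀ r : Config b, ‖flow m h r‖ ≤ C := by
  induction h with
  | zero => exact ⟨1, fun r => by simp [flow]⟩
  | succ h ih =>
    obtain ⟨C, hC⟩ := ih
    refine ⟨‖m⁻¹‖ * ∑ _i : Fin b, 1 * C, fun r => ?_⟩
    rw [flow, norm_mul]
    gcongr
    refine norm_sum_le_of_le _ fun i _ => ?_
    rw [norm_mul]
    gcongr
    · rw [Real.norm_natCast]; exact_mod_cast live_le_one (r []) i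
    · exact hC _

theorem exists_energy_le (b : ℕ) (m : ℝ) (h : ℕ) :
    ∃ C : ℝ, ∀ r : Config b, ‖energy m h r‖ ≤ C := by
  induction h with
  | zero => exact ⟨1, fun r => by simp [energy]⟩
  | succ h ih =>
    obtain ⟨C, hC⟩ := ih
    obtain ⟨D, hD⟩ := exists_flow_le b m (h + 1)
    refine ⟨D ^ 2 + ‖m⁻¹ ^ 2‖ * ∑ _i : Fin b, 1 * C, fun r => ?_⟩
    rw [energy]
    refine norm_add_le_of_le ?_ ?_
    · rw [norm_pow]; gcongr; exact hD r
    rw [norm_mul]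
    gcongr
    refine norm_sum_le_of_le _ fun i _ => ?_
    rw [norm_mul]
    gcongr
    · rw [Real.norm_natCast]; exact_mod_cast live_le_one (r []) i
    · exact hC _

theorem integral_mul_sub {b : ℕ} (μ : Measure (Fin (b + 1))) [IsProbabilityMeasure μ]
    (g : Fin (b + 1) → ℝ) {F : (Fin b → Config b) → ℝ} (hF : Measurable F) :
    ∫ r, g (r []) * F (fun i => sub r i) ∂(law b μ) =
      (∫ k, g k ∂μ) * ∫ r, F (fun i => sub r i) ∂(law b μ) := by
  have hs := measurePreserving_split b μ
  have hg : Measurable g := Measurable.of_discrete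
  have h1 : ∫ r, g (r []) * F (fun i => sub r i) ∂(law b μ) =
      ∫ p, g p.1 * F p.2 ∂(μ.prod (Measure.pi fun _ : Fin b => law b μ)) := by
    rw [← hs.map_eq, integral_map hs.measurable.aemeasurable]
    exact ((hg.comp measurable_fst).mul (hF.comp measurable_snd)).aestronglyMeasurable
  have hs2 := (measurePreserving_snd (μ := μ) (ν := Measure.pi fun _ : Fin b => law b μ)).comp hs
  have h2 : ∫ r, F (fun i => sub r i) ∂(law b μ) =
      ∫ x, F x ∂(Measure.pi fun _ : Fin b => law b μ) := by
    rw [← hs2.map_eq, integral_map hs2.measurable.aemeasurable hF.aestronglyMeasurable]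
    rfl
  rw [h1, h2, integral_prod_mul]

theorem integral_comp_sub {b : ℕ} (μ : Measure (Fin (b + 1))) [IsProbabilityMeasure μ]
    {f : Config b → ℝ} (hf : Measurable f) (i : Fin b) :
    ∫ r, f (sub r i) ∂(law b μ) = ∫ r, f r ∂(law b μ) := by
  have hs := measurePreserving_sub μ i
  conv_rhs => rw [← hs.map_eq, integral_map hs.measurable.aemeasurable hf.aestronglyMeasurable]

theorem iIndepFun_sub {b : ℕ} (μ : Measure (Fin (b + 1))) [IsProbabilityMeasure μ] :
    iIndepFun (fun i (r : Config b) => sub r i) (law b μ) := by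
  rw [iIndepFun_iff_map_fun_eq_pi_map fun i => (measurable_sub i).aemeasurable]
  have hs2 := (measurePreserving_snd (μ := μ) (ν := Measure.pi fun _ : Fin b => law b μ)).comp
    (measurePreserving_split b μ)
  have h := hs2.map_eq
  simp only [(measurePreserving_sub μ _).map_eq]
  exact h

theorem integrable_of_bounded {b : ℕ} (μ : Measure (Fin (b + 1))) [IsProbabilityMeasure μ]
    {f : Config b → ℝ} (hf : Measurable f) (h : ∃ C, ∀ r, ‖f r‖ ≤ C) :
    Integrable f (law b μ) :=
  Integrable.of_bound hf.aestronglyMeasurable h.choose (ae_of_all _ h.choose_spec)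

/-- The mean number of live children of a vertex. -/
noncomputable def meanLive {b : ℕ} (μ : Measure (Fin (b + 1))) : ℝ :=
  ∑ i : Fin b, ∫ k, (live k i : ℝ) ∂μ

section

variable {b : ℕ} (μ : Measure (Fin (b + 1))) [IsProbabilityMeasure μ] (m : ℝ)

theorem integrable_flow (h : ℕ) : Integrable (fun r : Config b => flow m h r) (law b μ) :=
  integrable_of_bounded μ (measurable_flow m h) (exists_flow_le b m h)

theorem integrable_energy (h : ℕ) : Integrable (fun r : Config b => energy m h r) (law b μ) :=
  integrable_of_bounded μ (measurable_energy m h) (exists_energy_le b m h)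

theorem integral_live_mul {f : Config b → ℝ} (hf : Measurable f) (i : Fin b) :
    ∫ r, (live (r []) i : ℝ) * f (sub r i) ∂(law b μ) =
      (∫ k, (live k i : ℝ) ∂μ) * ∫ r, f r ∂(law b μ) := by
  have := integral_mul_sub μ (fun k => (live k i : ℝ)) (F := fun x => f (x i))
    (hf.comp (measurable_pi_apply i))
  rw [this, integral_comp_sub μ hf]

theorem integral_sum_live_mul {f : Config b → ℝ} (hf : Measurable f) (hb : ∃ C, ∀ r, ‖f r‖ ≤ C) :
    ∫ r, ∑ i, (live (r []) i : ℝ) * f (sub r i) ∂(law b μ) =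
      meanLive μ * ∫ r, f r ∂(law b μ) := by
  rw [integral_finsetSum]
  · simp only [integral_live_mul μ hf, meanLive, Finset.sum_mul]
  · intro i _
    refine integrable_of_bounded μ ((measurable_live i).mul (hf.comp (measurable_sub i))) ?_
    obtain ⟨C, hC⟩ := hb
    refine ⟨1 * C, fun r => ?_⟩
    rw [norm_mul]
    gcongr
    · rw [Real.norm_natCast]; exact_mod_cast live_le_one (r []) i
    · exact hC _

theorem integral_flow (hm : 0 < meanLive μ) (h : ℕ) :
    ∫ r : Config b, flow (meanLive μ) h r ∂(law b μ) = 1 := by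
  induction h with
  | zero => simp [flow]
  | succ h ih =>
    simp only [flow]
    rw [integral_const_mul, integral_sum_live_mul μ (measurable_flow _ h) (exists_flow_le b _ h), ih,
      mul_one, inv_mul_cancel₀ hm.ne']

/-- Liveness of different children depends on the same rotor and is only bounded by one; the flows
in different branches are independent with mean one. -/
theorem integral_live_mul_live_le (hm : 0 < meanLive μ) (h : ℕ) (i j : Fin b) :
    ∫ r, ((live (r []) i : ℝ) * flow (meanLive μ) h (sub r i)) *
        ((live (r []) j : ℝ) * flow (meanLive μ) h (sub r j)) ∂(law b μ) ≤
      (if i = j then (∫ k, (live k i : ℝ) ∂μ) * ∫ r, flow (meanLive μ) h r ^ 2 ∂(law b μ)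
        else 0) + 1 := by
  set w : Config b → ℝ := fun r => flow (meanLive μ) h r with hw
  have hwm : Measurable w := measurable_flow _ h
  have hre : ∀ r : Config b, ((live (r []) i : ℝ) * flow (meanLive μ) h (sub r i)) *
      ((live (r []) j : ℝ) * flow (meanLive μ) h (sub r j)) =
      ((live (r []) i : ℝ) * live (r []) j) * (w (sub r i) * w (sub r j)) := fun r => by
    simp only [hw]; ring
  simp only [hre]
  have h1 := integral_mul_sub μ (fun k => (live k i : ℝ) * live k j)
    (F := fun x => w (x i) * w (x j))
    ((hwm.comp (measurable_pi_apply i)).mul (hwm.comp (measurable_pi_apply j)))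
  rw [h1]
  have hl : ∀ k : Fin (b + 1), ∀ i, (live k i : ℝ) ≤ 1 := fun k i => by
    exact_mod_cast live_le_one k i
  split_ifs with hij
  · subst hij
    have h2 : ∀ k : Fin (b + 1), (live k i : ℝ) * live k i = live k i := fun k => by
      unfold live; split_ifs <;> simp
    have h3 := integral_comp_sub μ (hwm.pow_const 2) i
    simp only [h2, ← sq]
    rw [h3]
    simp only [hw]
    linarith
  · have hind := ((iIndepFun_sub μ).indepFun hij).comp hwm hwm
    have h2 : ∫ r, w (sub r i) * w (sub r j) ∂(law b μ) = 1 := by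
      have := hind.integral_fun_mul_eq_mul_integral
        (hwm.comp (measurable_sub i)).aestronglyMeasurable
        (hwm.comp (measurable_sub j)).aestronglyMeasurable
      simp only [Function.comp_apply] at this
      rw [this, integral_comp_sub μ hwm, integral_comp_sub μ hwm]
      simp only [hw, integral_flow μ hm, mul_one]
    rw [h2, mul_one, zero_add]
    calc ∫ k, (live k i : ℝ) * live k j ∂μ ≤ ∫ _k, (1 : ℝ) ∂μ := by
          refine integral_mono Integrable.of_finite (integrable_const _) fun k => ?_
          exact mul_le_one₀ (hl k i) (by simp) (hl k j)
      _ = 1 := by simp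

theorem integral_sq_flow_succ_le (hm : 0 < meanLive μ) (h : ℕ) :
    ∫ r : Config b, flow (meanLive μ) (h + 1) r ^ 2 ∂(law b μ) ≤
      (meanLive μ)⁻¹ * ∫ r : Config b, flow (meanLive μ) h r ^ 2 ∂(law b μ) +
        (b : ℝ) ^ 2 * (meanLive μ)⁻¹ ^ 2 := by
  set M := meanLive μ
  set V := ∫ r : Config b, flow M h r ^ 2 ∂(law b μ)
  have hbd : ∀ i, ∃ C, ∀ r : Config b, ‖(live (r []) i : ℝ) * flow M h (sub r i)‖ ≤ C := by
    intro i
    obtain ⟨C, hC⟩ := exists_flow_le b M h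
    refine ⟨1 * C, fun r => ?_⟩
    rw [norm_mul]
    gcongr
    · rw [Real.norm_natCast]; exact_mod_cast live_le_one (r []) i
    · exact hC _
  have hmeas : ∀ i, Measurable fun r : Config b => (live (r []) i : ℝ) * flow M h (sub r i) :=
    fun i => (measurable_live i).mul ((measurable_flow M h).comp (measurable_sub i))
  have hint : ∀ i j, Integrable (fun r : Config b => ((live (r []) i : ℝ) * flow M h (sub r i)) *
      ((live (r []) j : ℝ) * flow M h (sub r j))) (law b μ) := by
    intro i j
    refine integrable_of_bounded μ ((hmeas i).mul (hmeas j)) ?_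
    obtain ⟨C, hC⟩ := hbd i
    obtain ⟨D, hD⟩ := hbd j
    refine ⟨C * D, fun r => ?_⟩
    rw [norm_mul]
    gcongr
    · exact (norm_nonneg _).trans (hC r)
    · exact hC r
    · exact hD r
  have h1 : ∫ r : Config b, flow M (h + 1) r ^ 2 ∂(law b μ) =
      M⁻¹ ^ 2 * ∑ i, ∑ j, ∫ r, ((live (r []) i : ℝ) * flow M h (sub r i)) *
        ((live (r []) j : ℝ) * flow M h (sub r j)) ∂(law b μ) := by
    simp only [flow, mul_pow]
    rw [integral_const_mul]
    congr 1
    simp only [sq, Finset.sum_mul_sum]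
    rw [integral_finsetSum _ fun i _ => integrable_finsetSum _ fun j _ => hint i j]
    refine Finset.sum_congr rfl fun i _ => ?_
    rw [integral_finsetSum _ fun j _ => hint i j]
  have h2 : ∑ i, ∑ j, ∫ r, ((live (r []) i : ℝ) * flow M h (sub r i)) *
        ((live (r []) j : ℝ) * flow M h (sub r j)) ∂(law b μ) ≤ M * V + (b : ℝ) ^ 2 := by
    calc _ ≤ ∑ i : Fin b, ∑ j : Fin b,
          ((if i = j then (∫ k, (live k i : ℝ) ∂μ) * V else 0) + 1) :=
        Finset.sum_le_sum fun i _ => Finset.sum_le_sum fun j _ =>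
          integral_live_mul_live_le μ hm h i j
      _ = M * V + (b : ℝ) ^ 2 := by
        simp only [Finset.sum_add_distrib, Finset.sum_ite_eq, Finset.mem_univ, if_true,
          ← Finset.sum_mul, Finset.sum_const, Finset.card_univ, Fintype.card_fin, nsmul_eq_mul]
        simp only [M, meanLive]
        ring
  rw [h1]
  calc M⁻¹ ^ 2 * _ ≤ M⁻¹ ^ 2 * (M * V + (b : ℝ) ^ 2) := by gcongr
    _ = _ := by field_simp

theorem exists_integral_energy_le (hm : 1 < meanLive μ) :
    ∃ K : ℝ, 0 < K ∧ ∀ h, ∫ r : Config b, energy (meanLive μ) h r ∂(law b μ) ≤ K := by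
  set M := meanLive μ with hM
  have hM0 : 0 < M := by linarith
  have hM1 : 0 < M - 1 := by linarith
  -- The fraction is the fixed point of `x ↦ x / M + b ^ 2 / M ^ 2`; adding `1` covers the initial
  -- value.
  set K := 1 + (b : ℝ) ^ 2 / (M * (M - 1)) with hK
  have hK1 : 1 ≤ K := le_add_of_nonneg_right (by positivity)
  have hV : ∀ h, ∫ r : Config b, flow M h r ^ 2 ∂(law b μ) ≤ K := by
    intro h
    induction h with
    | zero => simpa [flow] using hK1
    | succ h ih =>
      refine (integral_sq_flow_succ_le μ hM0 h).trans ?_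
      calc M⁻¹ * _ + (b : ℝ) ^ 2 * M⁻¹ ^ 2 ≤ M⁻¹ * K + (b : ℝ) ^ 2 * M⁻¹ ^ 2 := by gcongr
        _ ≤ K := by
          have : K - (M⁻¹ * K + (b : ℝ) ^ 2 * M⁻¹ ^ 2) = (M - 1) / M := by
            rw [hK]; field_simp; ring
          have h2 : 0 ≤ (M - 1) / M := by positivity
          linarith
  -- This is the fixed point of the energy recursion `x ↦ K + x / M`.
  refine ⟨K * M / (M - 1), by positivity, fun h => ?_⟩
  induction h with
  | zero =>
    simp only [energy, integral_const, probReal_univ, smul_eq_mul, mul_one]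
    rw [le_div_iff₀ hM1]
    nlinarith
  | succ h ih =>
    have hi1 : Integrable (fun r : Config b => flow M (h + 1) r ^ 2) (law b μ) := by
      refine integrable_of_bounded μ ((measurable_flow M (h + 1)).pow_const 2) ?_
      obtain ⟨D, hD⟩ := exists_flow_le b M (h + 1)
      exact ⟨D ^ 2, fun r => by rw [norm_pow]; gcongr; exact hD r⟩
    have hi2 : Integrable (fun r : Config b =>
        M⁻¹ ^ 2 * ∑ i, (live (r []) i : ℝ) * energy M h (sub r i)) (law b μ) := by
      have := (integrable_energy μ M (h + 1)).sub hi1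
      refine this.congr (ae_of_all _ fun r => ?_)
      simp [energy]
    calc ∫ r : Config b, energy M (h + 1) r ∂(law b μ)
        = ∫ r : Config b, flow M (h + 1) r ^ 2 ∂(law b μ) +
          M⁻¹ ^ 2 * (M * ∫ r : Config b, energy M h r ∂(law b μ)) := by
          rw [← integral_sum_live_mul μ (measurable_energy M h) (exists_energy_le b M h),
            ← integral_const_mul, ← integral_add hi1 hi2]
          rfl
      _ ≤ K + M⁻¹ ^ 2 * (M * (K * M / (M - 1))) := by
          gcongr
          exact hV (h + 1)
      _ = K * M / (M - 1) := by field_simp; ring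

end

theorem exists_pos_measure_rate {b : ℕ} (μ : Measure (Fin (b + 1))) [IsProbabilityMeasure μ]
    (hm : 1 < meanLive μ) :
    ∃ a : ℝ, 0 < a ∧ law b μ {r | ENNReal.ofReal a ≤ rate r} ≠ 0 := by
  obtain ⟨K, hK0, hK⟩ := exists_integral_energy_le μ hm
  set M := meanLive μ with hM
  set a := 1 / (2 * K) with ha
  have ha0 : 0 < a := by positivity
  set A : ℕ → Set (Config b) := fun h => {r | a * energy M h r < flow M h r ^ 2} with hA
  have hAm : ∀ h, MeasurableSet (A h) := fun h =>
    measurableSet_lt ((measurable_energy M h).const_mul a) ((measurable_flow M h).pow_const 2)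
  have hPA : ∀ h, a ≤ (law b μ).real (A h) := by
    intro h
    -- A pointwise inequality whose integral, with mean flow `1` and mean energy at most `K`, reads
    -- `2 ≤ 1 + K * P(A h) + 1 / 2`.
    have hpt : ∀ r : Config b, 2 * flow M h r ≤
        K⁻¹ * energy M h r + (K * (A h).indicator (fun _ => (1 : ℝ)) r + 1 / 2) := by
      intro r
      have he := sq_flow_le_energy (m := M) h r
      by_cases hr : r ∈ A h
      · rw [Set.indicator_of_mem hr, mul_one]
        have h1 : K⁻¹ * flow M h r ^ 2 ≤ K⁻¹ * energy M h r := by gcongr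
        have h2 : 2 * flow M h r ≤ K⁻¹ * flow M h r ^ 2 + K := by
          have : K⁻¹ * flow M h r ^ 2 + K - 2 * flow M h r = K⁻¹ * (flow M h r - K) ^ 2 := by
            field_simp; ring
          have : 0 ≤ K⁻¹ * (flow M h r - K) ^ 2 := by positivity
          linarith
        linarith
      · rw [Set.indicator_of_notMem hr]
        have h1 : flow M h r ^ 2 ≤ a * energy M h r := not_lt.1 hr
        have h2 : 2 * (a * energy M h r) = K⁻¹ * energy M h r := by
          rw [ha]; field_simp
        nlinarith [sq_nonneg (2 * flow M h r - 1)]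
    have hi1 := (integrable_energy μ M h).const_mul K⁻¹
    have hi2 : Integrable (fun r => K * (A h).indicator (fun _ => (1 : ℝ)) r + 1 / 2) (law b μ) :=
      (((integrable_const (1 : ℝ)).indicator (hAm h)).const_mul K).add (integrable_const _)
    have h1 := integral_mono ((integrable_flow μ M h).const_mul 2) (hi1.add hi2) hpt
    simp only [Pi.add_apply] at h1
    rw [integral_add hi1 hi2, integral_const_mul, integral_const_mul, integral_add
      (((integrable_const (1 : ℝ)).indicator (hAm h)).const_mul K) (integrable_const _),
      integral_const_mul, integral_indicator (hAm h), integral_flow μ (by linarith) h] at h1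
    simp only [integral_const, smul_eq_mul, mul_one, measureReal_restrict_apply_univ,
      probReal_univ] at h1
    have h2 : K⁻¹ * ∫ r : Config b, energy M h r ∂(law b μ) ≤ K⁻¹ * K := by
      gcongr; exact hK h
    rw [inv_mul_cancel₀ hK0.ne'] at h2
    rw [ha, div_le_iff₀ (by positivity)]
    linarith
  set D : ℕ → Set (Config b) := fun h => {r | ∀ n : ℕ, a * n ≤ levelCount h r n} with hD
  have hDm : ∀ h, MeasurableSet (D h) := fun h => by
    have : D h = ⋂ n : ℕ, {r | a * n ≤ levelCount h r n} := by ext r; simp [hD]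
    rw [this]
    refine MeasurableSet.iInter fun n => measurableSet_le measurable_const ?_
    exact (Measurable.of_discrete (f := fun k : ℕ => (k : ℝ))).comp (measurable_levelCount h n)
  have hAD : ∀ h, A h ⊆ D h := by
    intro h r hr n
    have hr' : a * energy M h r < flow M h r ^ 2 := hr
    have he : 0 < energy M h r := by
      have h1 := sq_flow_le_energy (m := M) h r
      have h2 := mul_nonneg ha0.le (energy_nonneg (m := M) h r)
      linarith
    have h3 := mul_sq_flow_le M h r n
    have h4 : (n : ℝ) * (a * energy M h r) ≤ n * flow M h r ^ 2 := by gcongr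
    refine le_of_mul_le_mul_right ?_ he
    linarith
  -- The events decrease with the level, so the uniform lower bound on their probabilities passes to
  -- the intersection.
  have hanti : Antitone D := fun h h' hh r hr n =>
    (hr n).trans (by exact_mod_cast levelCount_antitone r n hh)
  have hlim := tendsto_measure_iInter_atTop (μ := law b μ)
    (fun h => (hDm h).nullMeasurableSet) hanti ⟨0, measure_ne_top _ _⟩
  have hge : ENNReal.ofReal a ≤ law b μ (⋂ h, D h) := by
    refine ge_of_tendsto' hlim fun h => ?_
    refine le_trans ?_ (measure_mono (hAD h))
    rw [← ofReal_measureReal]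
    exact ENNReal.ofReal_le_ofReal (hPA h)
  refine ⟨a, ha0, fun h0 => ?_⟩
  have hsub : (⋂ h, D h) ⊆ {r : Config b | ENNReal.ofReal a ≤ rate r} := by
    intro r hr
    refine RateGE.le_rate ⟨0, fun n => ?_⟩
    obtain ⟨h, hh⟩ := exists_levelCount_eq r n
    rw [← hh, add_zero]
    exact Set.mem_iInter.1 hr h n
  have := hge.trans (measure_mono hsub)
  rw [h0] at this
  simp only [nonpos_iff_eq_zero, ENNReal.ofReal_eq_zero] at this
  linarith

/-! ### The rate of escape for small rotors -/

-- A layer-cake bound that turns tails at integers into a bound for the mean resistance.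
open scoped ENNReal NNReal in
theorem le_add_tsum_indicator (M : ℕ) (y : ℝ≥0∞) :
    y ≤ M + ∑' k : ℕ, if ((M + k : ℕ) : ℝ≥0∞) < y then 1 else 0 := by
  by_cases hy : y = ⊤
  · subst hy
    simp
  lift y to ℝ≥0 using hy
  set N := ⌈(y : ℝ) - M⌉₊
  have h1 : (N : ℝ≥0∞) ≤ ∑' k : ℕ, if ((M + k : ℕ) : ℝ≥0∞) < y then 1 else 0 := by
    calc (N : ℝ≥0∞) = ∑ k ∈ Finset.range N, if ((M + k : ℕ) : ℝ≥0∞) < y then 1 else 0 := by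
          rw [Finset.sum_congr rfl fun k hk => if_pos ?_]
          · simp
          · have h2 : (k : ℝ) < y - M := Nat.lt_ceil.1 (Finset.mem_range.1 hk)
            have h3 : ((M + k : ℕ) : ℝ) < y := by push_cast; linarith
            exact_mod_cast h3
      _ ≤ _ := ENNReal.sum_le_tsum _
  refine le_trans ?_ (add_le_add_right h1 _)
  have h2 : (y : ℝ) ≤ M + N := by linarith [Nat.le_ceil ((y : ℝ) - M)]
  exact_mod_cast h2

-- Resistance above `n + 1` forces resistance above `n` in each of the `b` independent branches.
open scoped ENNReal NNReal in
theorem law_lt_inv_rate_succ_le {b : ℕ} (μ : Measure (Fin (b + 1))) [IsProbabilityMeasure μ]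
    (n : ℕ) : law b μ {r | ((n + 1 : ℕ) : ℝ≥0∞) < (rate r)⁻¹} ≤
      law b μ {r | (n : ℝ≥0∞) < (rate r)⁻¹} ^ b := by
  have hm : MeasurableSet {r : Config b | (n : ℝ≥0∞) < (rate r)⁻¹} :=
    measurableSet_lt measurable_const measurable_rate.inv
  have h := law_inter_sub μ Set.univ (B := fun _ => {r | (n : ℝ≥0∞) < (rate r)⁻¹}) fun _ => hm
  simp only [Finset.prod_const, Finset.card_univ, Fintype.card_fin, measure_univ, one_mul] at h
  rw [← h]
  refine measure_mono fun r hr => ⟨Set.mem_univ _, fun i => ?_⟩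
  have h1 : ((n + 1 : ℕ) : ℝ≥0∞) < 1 + (rate (sub r i))⁻¹ :=
    lt_of_lt_of_le hr (inv_rate_le_one_add r i)
  rw [Nat.cast_add, Nat.cast_one, add_comm] at h1
  exact lt_of_add_lt_add_left h1

open scoped ENNReal NNReal in
theorem lintegral_inv_rate_ne_top {b : ℕ} (hb : 2 ≤ b) (μ : Measure (Fin (b + 1)))
    [IsProbabilityMeasure μ] (hm : 1 < meanLive μ) :
    ∫⁻ r : Config b, (rate r)⁻¹ ∂(law b μ) ≠ ⊤ := by
  obtain ⟨a, ha, hpos⟩ := exists_pos_measure_rate μ hm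
  obtain ⟨M, hM⟩ := exists_nat_ge a⁻¹
  set p : ℕ → ℝ≥0∞ := fun k => law b μ {r | ((M + k : ℕ) : ℝ≥0∞) < (rate r)⁻¹} with hp
  have hmeas : ∀ k : ℕ, MeasurableSet {r : Config b | (k : ℝ≥0∞) < (rate r)⁻¹} := fun k =>
    measurableSet_lt measurable_const measurable_rate.inv
  have hp0 : p 0 < 1 := by
    refine lt_of_le_of_ne prob_le_one fun h1 => hpos ?_
    have h2 := (prob_compl_eq_zero_iff (hmeas (M + 0))).2 h1
    refine measure_mono_null (fun r hr => ?_) h2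
    have hr' : ENNReal.ofReal a ≤ rate r := hr
    simp only [Set.mem_compl_iff, Set.mem_ofPred_eq, not_lt, add_zero]
    refine (ENNReal.inv_le_inv.2 hr').trans ?_
    rw [← ENNReal.ofReal_inv_of_pos ha]
    exact (ENNReal.ofReal_le_ofReal hM).trans_eq (ENNReal.ofReal_natCast M)
  have hle : ∀ k, p k ≤ p 0 := fun k => measure_mono fun r hr => by
    have hr' : ((M + k : ℕ) : ℝ≥0∞) < (rate r)⁻¹ := hr
    exact lt_of_le_of_lt (Nat.cast_le.2 (by omega : M + 0 ≤ M + k)) hr'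
  have hgeo : ∀ k, p k ≤ p 0 ^ (k + 1) := by
    intro k
    induction k with
    | zero => simp
    | succ k ih =>
      calc p (k + 1) ≤ p k ^ b := law_lt_inv_rate_succ_le μ (M + k)
        _ ≤ p k ^ 2 := pow_le_pow_of_le_one zero_le prob_le_one hb
        _ = p k * p k := sq _
        _ ≤ p 0 ^ (k + 1) * p 0 := mul_le_mul' ih (hle k)
        _ = _ := (pow_succ _ _).symm
  have hbound : ∫⁻ r : Config b, (rate r)⁻¹ ∂(law b μ) ≤ M + ∑' k, p k := by
    calc ∫⁻ r : Config b, (rate r)⁻¹ ∂(law b μ)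
        ≤ ∫⁻ r : Config b, (M + ∑' k : ℕ,
          if ((M + k : ℕ) : ℝ≥0∞) < (rate r)⁻¹ then 1 else 0) ∂(law b μ) :=
          lintegral_mono fun r => le_add_tsum_indicator M _
      _ = M + ∑' k, p k := by
          rw [lintegral_add_left measurable_const, lintegral_tsum fun k =>
            (Measurable.ite (hmeas _) measurable_const measurable_const).aemeasurable]
          simp only [lintegral_const, measure_univ, mul_one]
          congr 2
          funext k
          refine Eq.trans ?_ (lintegral_indicator_one (hmeas (M + k)))
          exact lintegral_congr fun r => by simp [Set.indicator_apply]
  refine ne_top_of_le_ne_top ?_ (hbound.trans (add_le_add_right (ENNReal.tsum_le_tsum hgeo) _))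
  simp only [pow_succ, ENNReal.tsum_mul_right, ENNReal.tsum_geometric]
  refine ENNReal.add_ne_top.2 ⟨by simp, ENNReal.mul_ne_top ?_ hp0.ne_top⟩
  exact ENNReal.inv_ne_top.2 (tsub_pos_of_lt hp0).ne'

-- Finiteness of the mean resistance `I` allows `I ≤ 1 + I / b` to be solved for `I`; the pointwise
-- bound `rate_le` then leaves no room.
open scoped ENNReal NNReal in
theorem ae_rate_eq {b : ℕ} (hb : 2 ≤ b) (μ : Measure (Fin (b + 1)))
    [IsProbabilityMeasure μ] (hm : 1 < meanLive μ) :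
    ∀ᵐ r ∂(law b μ), rate r = ENNReal.ofReal (((b : ℝ) - 1) / b) := by
  have hb' : (2 : ℝ) ≤ b := by exact_mod_cast hb
  have hc0 : 0 < ((b : ℝ) - 1) / b := div_pos (by linarith) (by linarith)
  set c := ENNReal.ofReal (((b : ℝ) - 1) / b) with hc
  set I := ∫⁻ r : Config b, (rate r)⁻¹ ∂(law b μ) with hI
  have hIt : I ≠ ⊤ := lintegral_inv_rate_ne_top hb μ hm
  have hsm : ∀ i : Fin b, Measurable fun r : Config b => (rate (sub r i))⁻¹ := fun i =>
    (measurable_rate.comp (measurable_sub i)).inv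
  have h1 : I ≤ 1 + (∑ _i : Fin b, I) / (b : ℝ≥0∞) ^ 2 := by
    calc I ≤ ∫⁻ r : Config b, (1 + (∑ i, (rate (sub r i))⁻¹) / (b : ℝ≥0∞) ^ 2) ∂(law b μ) :=
          lintegral_mono fun r => inv_rate_le_one_add_sum (by omega) r
      _ = 1 + (∑ i : Fin b, ∫⁻ r : Config b, (rate (sub r i))⁻¹ ∂(law b μ)) / (b : ℝ≥0∞) ^ 2 := by
          rw [lintegral_add_left measurable_const]
          simp only [lintegral_const, measure_univ, mul_one, div_eq_mul_inv]
          rw [lintegral_mul_const _ (Finset.measurable_sum _ fun i _ => hsm i),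
            lintegral_finsetSum _ fun i _ => hsm i]
      _ = _ := by
          congr 3
          funext i
          exact (measurePreserving_sub μ i).lintegral_comp measurable_rate.inv
  have h2 : I.toReal ≤ (((b : ℝ) - 1) / b)⁻¹ := by
    have hfin : (∑ _i : Fin b, I) / (b : ℝ≥0∞) ^ 2 ≠ ⊤ :=
      ENNReal.div_ne_top (ENNReal.sum_ne_top.2 fun _ _ => hIt) (by positivity)
    have h3 := ENNReal.toReal_mono (ENNReal.add_ne_top.2 ⟨by simp, hfin⟩) h1
    rw [ENNReal.toReal_add (by simp) hfin, ENNReal.toReal_div] at h3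
    simp only [Finset.sum_const, Finset.card_univ, Fintype.card_fin, nsmul_eq_mul,
      ENNReal.toReal_one, ENNReal.toReal_mul, ENNReal.toReal_natCast, ENNReal.toReal_pow] at h3
    have h4 : (b : ℝ) * I.toReal / (b : ℝ) ^ 2 = I.toReal / b := by
      field_simp
    rw [h4] at h3
    have h5 := mul_le_mul_of_nonneg_right h3 (by linarith : (0 : ℝ) ≤ b)
    rw [add_mul, div_mul_cancel₀ _ (by linarith : (b : ℝ) ≠ 0)] at h5
    rw [inv_div, le_div_iff₀ (by linarith)]
    linarith
  have h3 : I ≤ c⁻¹ := by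
    rw [hc, ← ENNReal.ofReal_inv_of_pos hc0]
    exact (ENNReal.le_ofReal_iff_toReal_le hIt (by positivity)).2 h2
  have h4 : (fun _ : Config b => c⁻¹) =ᵐ[law b μ] fun r => (rate r)⁻¹ := by
    refine ae_eq_of_ae_le_of_lintegral_le
      (ae_of_all _ fun r => ENNReal.inv_le_inv.2 (rate_le hb r)) ?_ measurable_rate.inv.aemeasurable ?_
    · simp only [lintegral_const, measure_univ, mul_one]
      exact ENNReal.inv_ne_top.2 (ENNReal.ofReal_pos.2 hc0).ne'
    · simpa using h3
  filter_upwards [h4] with r hr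
  exact (inv_injective hr).symm

/-! ### The escape probability of simple random walk -/

/-- The walk started at `x` and driven by `u` is at the root at some time up to `t`. -/
def HitsBy {b : ℕ} : ℕ → Vertex b → (ℕ → Fin (b + 1)) → Prop
  | _, none, _ => True
  | 0, some _, _ => False
  | t + 1, some v, u => HitsBy t (nbr v (u 0)) fun k => u (k + 1)

/-- The distance to the root. -/
def height {b : ℕ} : Vertex b → ℕ
  | none => 0
  | some v => v.length + 1

theorem height_parent {b : ℕ} (v : NonRoot b) : height (parent v) = v.length := by
  cases v <;> rfl

/-- The probability that a walk on `ℕ` with a step down of probability `1 / (b + 1)` and a step up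
of probability `b / (b + 1)` goes from `k` to `0` in at most `t` steps. -/
noncomputable def hitProb (b : ℕ) : ℕ → ℕ → ℝ
  | _, 0 => 1
  | 0, _ + 1 => 0
  | t + 1, k + 1 => (hitProb b t k + b * hitProb b t (k + 2)) / (b + 1)

/-- Splitting off the first term of a sequence. -/
def natOptionEquiv : Option ℕ ≃ ℕ where
  toFun o := o.elim 0 Nat.succ
  invFun n := n.casesOn none some
  left_inv o := by cases o <;> rfl
  right_inv n := by cases n <;> rfl

/-- The law of a sequence of independent uniform choices of neighbours. -/
noncomputable abbrev choices (b : ℕ) : Measure (ℕ → Fin (b + 1)) :=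
  Measure.infinitePi fun _ : ℕ => (PMF.uniformOfFintype (Fin (b + 1))).toMeasure

theorem measurePreserving_choices (b : ℕ) :
    MeasurePreserving (fun u : ℕ → Fin (b + 1) => (u 0, fun k => u (k + 1))) (choices b)
      ((PMF.uniformOfFintype (Fin (b + 1))).toMeasure.prod (choices b)) :=
  ⟨by fun_prop, map_infinitePi_option (PMF.uniformOfFintype (Fin (b + 1))).toMeasure natOptionEquiv⟩

theorem measurableSet_hitsBy {b : ℕ} (t : ℕ) (x : Vertex b) : MeasurableSet {u | HitsBy t x u} := by
  induction t generalizing x with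
  | zero => cases x <;> simp [HitsBy]
  | succ t ih =>
    cases x with
    | none => simp [HitsBy]
    | some v =>
      have : {u | HitsBy (t + 1) (some v) u} =
          ⋃ k, ({u | u 0 = k} ∩ (fun (u : ℕ → Fin (b + 1)) k => u (k + 1)) ⁻¹'
            {u | HitsBy t (nbr v k) u}) := by
        ext u; simp [HitsBy]
      rw [this]
      refine MeasurableSet.iUnion fun k => MeasurableSet.inter ?_ ?_
      · exact measurableSet_eq_fun (measurable_pi_apply 0) measurable_const
      · exact (by fun_prop : Measurable fun (u : ℕ → Fin (b + 1)) k => u (k + 1)) (ih _)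

theorem choices_hitsBy {b : ℕ} (t : ℕ) (x : Vertex b) :
    (choices b).real {u | HitsBy t x u} = hitProb b t (height x) := by
  induction t generalizing x with
  | zero => cases x <;> simp [HitsBy, height, hitProb]
  | succ t ih =>
    cases x with
    | none => simp [HitsBy, height, hitProb]
    | some v =>
      set S : Set (Fin (b + 1) × (ℕ → Fin (b + 1))) := {p | HitsBy t (nbr v p.1) p.2} with hS
      have hSm : MeasurableSet S := by
        have : S = ⋃ k, {k} ×ˢ {u | HitsBy t (nbr v k) u} := by ext p; simp [hS]
        rw [this]
        exact MeasurableSet.iUnion fun k =>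
          (measurableSet_singleton k).prod (measurableSet_hitsBy t _)
      have h1 : choices b {u | HitsBy (t + 1) (some v) u} =
          ((PMF.uniformOfFintype (Fin (b + 1))).toMeasure.prod (choices b)) S :=
        (measurePreserving_choices b).measure_preimage hSm.nullMeasurableSet
      rw [Measure.prod_apply hSm, lintegral_fintype] at h1
      rw [measureReal_def, h1, ENNReal.toReal_sum fun k _ => by finiteness]
      have h2 : ∀ k, (choices b (Prod.mk k ⁻¹' S) *
          (PMF.uniformOfFintype (Fin (b + 1))).toMeasure {k}).toReal =
          hitProb b t (height (nbr v k)) / (b + 1) := by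
        intro k
        rw [ENNReal.toReal_mul, PMF.toMeasure_apply_singleton _ _ (measurableSet_singleton k),
          PMF.uniformOfFintype_apply, ← ih, div_eq_mul_inv]
        simp [measureReal_def, hS, ENNReal.toReal_add]
      simp only [h2, Fin.sum_univ_succ]
      have h3 : height (nbr v 0) = v.length := height_parent v
      have h4 : ∀ i : Fin b, height (nbr v i.succ) = v.length + 2 := fun i => rfl
      rw [show height (some v) = v.length + 1 from rfl]
      simp only [h3, h4, hitProb, Finset.sum_const, Finset.card_univ, Fintype.card_fin,
        nsmul_eq_mul]
      ring

/-- For the height chain `b ^ (-k)` is harmonic, and `b ^ (-k / 2)` is an eigenfunction with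
eigenvalue `2 * √b / (b + 1) < 1`. Both bounds are thus preserved by the recursion. -/
theorem hitProb_bounds {b : ℕ} (hb : 2 ≤ b) (t k : ℕ) :
    hitProb b t k ≤ (1 / (b : ℝ)) ^ k ∧
      (1 / (b : ℝ)) ^ k - (2 * √b / (b + 1)) ^ t * (1 / √b) ^ k ≤ hitProb b t k := by
  have hb0 : (0 : ℝ) < b := by exact_mod_cast (by omega : 0 < b)
  have hs0 : 0 < √(b : ℝ) := Real.sqrt_pos.2 hb0
  have hs : √(b : ℝ) ^ 2 = b := Real.sq_sqrt hb0.le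
  have hs1 : 1 ≤ √(b : ℝ) := Real.one_le_sqrt.2 (by exact_mod_cast (by omega : 1 ≤ b))
  set s := √(b : ℝ)
  rw [← hs]
  induction t generalizing k with
  | zero =>
    cases k with
    | zero => simp [hitProb]
    | succ k =>
      simp only [hitProb, pow_zero, one_mul]
      refine ⟨by positivity, ?_⟩
      rw [sub_nonpos]
      refine pow_le_pow_left₀ (by positivity) ?_ _
      rw [div_le_div_iff₀ (by positivity) hs0]
      nlinarith
  | succ t ih =>
    cases k with
    | zero =>
      simp only [hitProb, pow_zero, mul_one, le_refl, true_and, sub_le_self_iff]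
      positivity
    | succ k =>
      obtain ⟨h1, h2⟩ := ih k
      obtain ⟨h3, h4⟩ := ih (k + 2)
      simp only [hitProb]
      rw [← hs]
      have hpos : 0 < s ^ 2 + 1 := by positivity
      constructor
      · rw [div_le_iff₀ hpos]
        have e1 : (1 / s ^ 2) ^ (k + 1) * (s ^ 2 + 1) =
            (1 / s ^ 2) ^ k + s ^ 2 * (1 / s ^ 2) ^ (k + 2) := by
          simp only [pow_succ]; field_simp
        rw [e1]
        gcongr
      · rw [le_div_iff₀ hpos]
        have e1 : ((1 / s ^ 2) ^ (k + 1) -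
            (2 * s / (s ^ 2 + 1)) ^ (t + 1) * (1 / s) ^ (k + 1)) * (s ^ 2 + 1) =
            ((1 / s ^ 2) ^ k - (2 * s / (s ^ 2 + 1)) ^ t * (1 / s) ^ k) +
            s ^ 2 * ((1 / s ^ 2) ^ (k + 2) - (2 * s / (s ^ 2 + 1)) ^ t * (1 / s) ^ (k + 2)) := by
          simp only [pow_succ]; field_simp; ring
        rw [e1]
        gcongr

theorem tendsto_hitProb_one {b : ℕ} (hb : 2 ≤ b) :
    Tendsto (fun t => hitProb b t 1) atTop (𝓝 (1 / (b : ℝ))) := by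
  have hb0 : (2 : ℝ) ≤ b := by exact_mod_cast hb
  have hs : √(b : ℝ) ^ 2 = b := Real.sq_sqrt (by linarith)
  have hs1 : 1 < √(b : ℝ) := by
    rw [Real.lt_sqrt (by norm_num)]; linarith
  have hlt : 2 * √(b : ℝ) / (b + 1) < 1 := by
    rw [div_lt_one (by linarith)]
    nlinarith
  have hpow := (tendsto_pow_atTop_nhds_zero_of_lt_one
    (by positivity : 0 ≤ 2 * √(b : ℝ) / (b + 1)) hlt).mul_const (1 / √(b : ℝ))
  rw [zero_mul] at hpow
  have hlow := (tendsto_const_nhds (x := 1 / (b : ℝ))).sub hpow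
  rw [sub_zero] at hlow
  refine tendsto_of_tendsto_of_tendsto_of_le_of_le hlow tendsto_const_nhds
    (fun t => ?_) fun t => ?_
  · simpa using (hitProb_bounds hb t 1).2
  · simpa using (hitProb_bounds hb t 1).1

theorem hitsBy_srw_iff {b : ℕ} (u : ℕ → Fin (b + 1)) (t s : ℕ) :
    HitsBy t (srw u s) (fun k => u (s + k)) ↔ ∃ j ≤ t, srw u (s + j) = none := by
  induction t generalizing s with
  | zero =>
    cases h : srw u s <;> simp [HitsBy, h]
  | succ t ih =>
    cases h : srw u s with
    | none => simpa [HitsBy] using ⟨0, by omega, h⟩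
    | some v =>
      have h1 : srw u (s + 1) = nbr v (u s) := by simp [srw, h]
      have h2 : HitsBy (t + 1) (some v) (fun k => u (s + k)) ↔
          HitsBy t (srw u (s + 1)) (fun k => u (s + 1 + k)) := by
        rw [h1, HitsBy]
        simp only [add_zero, add_assoc, add_comm 1]
      rw [h2, ih]
      constructor
      · rintro ⟨j, hj, hj'⟩
        exact ⟨j + 1, by omega, by rwa [← add_assoc, add_right_comm]⟩
      · rintro ⟨j, hj, hj'⟩
        cases j with
        | zero => rw [add_zero, h] at hj'; exact absurd hj' (by simp)
        | succ j => exact ⟨j, by omega, by rwa [add_assoc, add_comm 1]⟩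

theorem escapeProb_eq {b : ℕ} (hb : 2 ≤ b) : escapeProb b = ((b : ℝ) - 1) / b := by
  have hb0 : (2 : ℝ) ≤ b := by exact_mod_cast hb
  -- The forced first step ignores `u 0`, so the walk restarted at `[]` is driven by the shifted
  -- sequence.
  set H : ℕ → Set (ℕ → Fin (b + 1)) := fun t =>
    (fun (u : ℕ → Fin (b + 1)) k => u (k + 1)) ⁻¹' {u | HitsBy t (some []) u} with hH
  have hshift : MeasurePreserving (fun (u : ℕ → Fin (b + 1)) k => u (k + 1))
      (choices b) (choices b) := measurePreserving_snd.comp (measurePreserving_choices b)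
  have hHm : ∀ t, MeasurableSet (H t) := fun t => hshift.measurable (measurableSet_hitsBy t _)
  have hHiff : ∀ t u, u ∈ H t ↔ ∃ j ≤ t, srw u (1 + j) = none := fun t u => by
    rw [← hitsBy_srw_iff u t 1]
    simp only [hH, Set.mem_preimage, Set.mem_ofPred_eq, add_comm 1]
    rfl
  have hmono : Monotone H := fun t t' ht u hu => by
    rw [hHiff] at hu ⊢
    obtain ⟨j, hj, h⟩ := hu
    exact ⟨j, hj.trans ht, h⟩
  have hcompl : {u : ℕ → Fin (b + 1) | ∀ t : ℕ, 1 ≤ t → srw u t ≠ none} = (⋃ t, H t)ᶜ := by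
    ext u
    simp only [Set.mem_ofPred_eq, Set.mem_compl_iff, Set.mem_iUnion, hHiff]
    constructor
    · rintro h ⟨t, j, -, hj⟩
      exact h _ (by omega) hj
    · intro h t ht h0
      exact h ⟨t, t - 1, by omega, by rwa [Nat.add_sub_cancel' ht]⟩
  have hlim := (ENNReal.tendsto_toReal (measure_ne_top (choices b) _)).comp
    (tendsto_measure_iUnion_atTop (μ := choices b) hmono)
  have hval : ∀ t, (choices b (H t)).toReal = hitProb b t 1 := fun t => by
    rw [hshift.measure_preimage (measurableSet_hitsBy t _).nullMeasurableSet]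
    exact choices_hitsBy t (some [])
  have heq : (choices b).real (⋃ t, H t) = 1 / b :=
    tendsto_nhds_unique (hlim.congr hval) (tendsto_hitProb_one hb)
  rw [escapeProb, hcompl, probReal_compl_eq_one_sub (MeasurableSet.iUnion hHm), heq]
  field_simp

theorem meanLive_eq {b : ℕ} (μ : Measure (Fin (b + 1))) [IsProbabilityMeasure μ] :
    meanLive μ = b - ∫ k, ((k : ℕ) : ℝ) ∂μ := by
  rw [meanLive, ← integral_finsetSum _ fun i _ => Integrable.of_finite]
  have : ∀ k : Fin (b + 1), ∑ i, (live k i : ℝ) = b - (k : ℕ) := by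
    intro k
    rw [← Nat.cast_sub (Nat.lt_succ_iff.1 k.isLt), ← card_live, Finset.card_filter]
    push_cast
    simp [live]
  simp only [this]
  rw [MeasureTheory.integral_sub (integrable_const _) Integrable.of_finite]
  simp

end RotorTree

theorem theorem6 (b : ℕ) (hb : 2 ≤ b)
    {Ω : Type*} [MeasurableSpace Ω] (P : Measure Ω) [IsProbabilityMeasure P]
    (R : RotorTree.NonRoot b → Ω → Fin (b + 1))
    (hmeas : ∀ w, Measurable (R w))
    (hindep : iIndepFun R P)
    (hident : ∀ w w', IdentDistrib (R w) (R w') P P)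
    (v : RotorTree.NonRoot b)
    (hnondet : ¬ ∃ k : Fin (b + 1), ∀ᵐ ω ∂P, R v ω = k) :
    RotorTree.escapeProb b = ((b : ℝ) - 1) / b ∧
    (∫ ω, ((R v ω : ℕ) : ℝ) ∂P < (b : ℝ) - 1 →
      ∀ᵐ ω ∂P, Tendsto
        (fun n : ℕ => (RotorTree.escapeCount (fun w => R w ω) n : ℝ) / (n : ℝ))
        atTop (𝓝 (RotorTree.escapeProb b))) ∧
    ((b : ℝ) - 1 ≤ ∫ ω, ((R v ω : ℕ) : ℝ) ∂P →
      ∀ᵐ ω ∂P, ∀ n : ℕ, RotorTree.escapeCount (fun w => R w ω) n = 0) := by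
  set μ : Measure (Fin (b + 1)) := P.map (R v) with hμ
  have hμp : IsProbabilityMeasure μ := Measure.isProbabilityMeasure_map (hmeas v).aemeasurable
  have hlaw : P.map (fun ω w => R w ω) = RotorTree.law b μ := by
    rw [hindep.map_fun_eq_infinitePi_map hmeas]
    congr 1
    funext w
    exact (hident w v).map_eq
  have hRm : Measurable fun ω w => R w ω := measurable_pi_lambda _ hmeas
  have hint : ∫ ω, ((R v ω : ℕ) : ℝ) ∂P = ∫ k, ((k : ℕ) : ℝ) ∂μ :=
    (integral_map (hmeas v).aemeasurable
      (Measurable.of_discrete (f := fun k : Fin (b + 1) => ((k : ℕ) : ℝ))).aestronglyMeasurable).symm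
  have hE := RotorTree.escapeProb_eq hb
  rw [hE, hint]
  refine ⟨rfl, fun hlt => ?_, fun hge => ?_⟩
  · have hrate := RotorTree.ae_rate_eq hb μ (by rw [RotorTree.meanLive_eq]; linarith)
    rw [← hlaw] at hrate
    filter_upwards [ae_of_ae_map hRm.aemeasurable hrate] with ω hω
    exact RotorTree.tendsto_of_le_rate hb _ hω.ge
  · have hnd : ∀ k, μ.real {k} ≠ 1 := by
      intro k hk
      refine hnondet ⟨k, ?_⟩
      rw [measureReal_def, ENNReal.toReal_eq_one_iff, hμ,
        Measure.map_apply (hmeas v) (measurableSet_singleton k)] at hk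
      exact (prob_compl_eq_zero_iff (hmeas v (measurableSet_singleton k))).2 hk
    rw [integral_fintype Integrable.of_finite] at hge
    have h0 := ae_all_iff.2 (RotorTree.ae_escapeCount_eq_zero μ hnd (by simpa using hge))
    rw [← hlaw] at h0
    exact ae_of_ae_map hRm.aemeasurable h0
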